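/- **Setting.** Consider an $N$-player stochastic Nash game: player $i$ chooses $x_i\in X_i\subseteq\mathbb R^{n_i}$ to minimize $f_i(x_i,x_{-i})=\mathbb E[\psi_i(x_i,x_{-i};\xi)]$, $\xi:\Omega\to\mathbb R^d$ a random vector on a probability space; $X=\prod_i X_i$; $x^*$ is a Nash equilibrium. Assume for every $i$: * $X_i$ is compact and convex; for every $x_{-i}\in X_{-i}$, $f_i(\cdot,x_{-i})$ is finite, convex and twice continuously differentiable on an open set containing $X_i$; for $j\ne i$ the mixed second derivatives $\nabla^2_{x_ix_j}f_i$ exist and are bounded on $X$; * for every $x_{-i}\in X_{-i}$ and every $\omega$, $\psi_i(\cdot,x_{-i};\xi(\omega))$ is differentiable on an open set containing $X_i$; $\nabla_{x_i}\psi_i$ is jointly measurable on $X\times\mathbb R^d$; for all $x\in X$, $\nabla_{x_i}f_i(x)=\mathbb E[\nabla_{x_i}\psi_i(x;\xi)]$ and $\mathbb E\|\nabla_{x_i}\psi_i(x;\xi)\|^2\le M_i^2$, where $M_i>0$. Let $\mu>0$, $\zeta_{i,\min}=\inf_{x\in X}\lambda_{\min}(\nabla^2_{x_i}f_i(x))$,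 $\zeta_{ij,\max}=\sup_{x\in X}\|\nabla^2_{x_ix_j}f_i(x)\|$, and let $\Gamma$ be the $N\times N$ matrix with $\Gamma_{ii}=\frac{\mu}{\mu+\zeta_{i,\min}}$ and $\Gamma_{ij}=\frac{\zeta_{ij,\max}}{\mu+\zeta_{i,\min}}$ ($j\neq i$). Assume $a:=\|\Gamma\|<1$ (spectral norm). Let $\widehat x_i(y)=\operatorname{argmin}_{z\in X_i}\big[f_i(z,y_{-i})+\frac\mu2\|z-y_i\|^2\big]$ and $Q_i=\frac{2M_i^2}{\mu^2}+2D_{X_i}^2$ with $D_{X_i}$ the diameter of $X_i$. **Scheme.** Let $\eta\in(0,1)$. The initial profile $x_0$ is random (possibly deterministic) with values in $X$ and $\mathbb E\|x_{i,0}-x_i^*\|^2\le C^2$ for all $i$, where $C\ge0$. For each $i$, $(\chi_{i,k})_{k\ge0}$ are i.i.d. Bernoulli variables with $\mathbb P(\chi_{i,k}=1)=p_i>0$; put $p_{\min}=\min_ip_i$, $p_{\max}=\max_ip_i$ and $\beta_{i,k}=\sum_{l<k}\chi_{i,l}$. At major iteration $k$, if $\chi_{i,k}=0$ then $x_{i,k+1}=x_{i,k}$;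 if $\chi_{i,k}=1$, player $i$ takes $j_{i,k}=\lceil Q_i/\eta^{2(\beta_{i,k}+1)}\rceil$ projected stochastic gradient (SG) steps $$z_{i,t+1}=\Pi_{X_i}\Big[z_{i,t}-\tfrac1{\mu(t+1)}\big(\nabla_{x_i}\psi_i(z_{i,t},x_{-i,k};\xi_{i,k}^t)+\mu(z_{i,t}-x_{i,k})\big)\Big],\quad t=1,\dots,j_{i,k},\qquad z_{i,1}=x_{i,k},$$ and $x_{i,k+1}$ is the resulting point. Let $\mathcal F_k$ be the $\sigma$-field generated by $x_0$, by all $\chi_{i,l}$ with $l<k$, and by the samples used at the major iterations $l<k$. For all $i,k$: $\chi_{i,k}$ is independent of $\mathcal F_k$, and the samples $(\xi^t_{i,k})_{t\ge1}$ are i.i.d. copies of $\xi$, jointly independent of $\mathcal F_k\vee\sigma(\chi_{i,k})$. A random profile $x$ is an $\epsilon$-NE$_2$ if $\mathbb E\big(\sum_i\|x_i-x_i^*\|^2\big)^{1/2}\le\epsilon$. **Notation.** Let $\tilde a^2=1-p_{\min}(1-a^2)$, $\tilde\eta^2=1-p_{\min}(1-\eta^2)$, $\tilde\eta_0^{-2}=1+p_{\max}(\eta^{-2}-1)$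 (all of $\tilde a,\tilde\eta,\tilde\eta_0\ge0$), $\tilde c=\max\{\tilde a,\tilde\eta\}$. For $\tilde q\in(\tilde c,1)$ and $\epsilon>0$ let $D=\frac1{\ln((\tilde q/\tilde c)^e)}$, $\widetilde C=C\big(\sum_iN^{-1}p_i^{-1}\big)^{1/2}$, $\widetilde D=D\eta\tilde\eta^{-1}$, $\tilde\epsilon=\frac{\epsilon}{(Np_{\max})^{1/2}(\widetilde C+\widetilde D)}$, and $$\tilde\ell_i(\eta)=\frac{p_iQ_i}{\eta^2\tilde\eta_0^2\ln(1/\tilde\eta_0^2)}\Big(\frac1{\tilde\epsilon}\Big)^{\frac{\ln(1/\tilde\eta_0^2)}{\ln(1/\tilde q)}}+\Big\lceil\frac{\ln(1/\tilde\epsilon)}{\ln(1/\tilde q)}\Big\rceil_+,\qquad \lceil s\rceil_+:=\max\{\lceil s\rceil,0\}.$$ **Theorem.** 1. For all $i,k$, the output $z$ of the $j_{i,k}$ SG steps of player $i$ at $x_k$ satisfies $\mathbb E[\|z-\widehat x_i(x_k)\|^2\mid\mathcal F_k]\le\alpha_{i,k}^2$ a.s. with $\alpha_{i,k}=\eta^{\beta_{i,k}+1}$.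 2. For every $\tilde q\in(\tilde c,1)$ and $\epsilon>0$ there is $K$ such that $x_k$ is an $\epsilon$-NE$_2$ for all $k\ge K$ and, for every player $i$, the expected number $\mathbb E\big[\sum_{k<K}\chi_{i,k}j_{i,k}\big]$ of projected SG steps taken before $x_K$ is reached is at most $\tilde\ell_i(\eta)$. 3. Suppose $\eta=a$ and $\delta>0$. Then $\tilde q:=\tilde\eta e^{\delta_0/2}$ with $\delta_0=\frac{\delta\ln(\tilde\eta^{-1})}{\ln(\tilde\eta_0^{-1})/\ln(\tilde\eta^{-1})+\delta/2}$ lies in $(\tilde c,1)$, and for this $\tilde q$, every $\epsilon>0$ and every $i$, $$\tilde\ell_i(\eta)\le\frac{p_iQ_i}{\tilde\eta_0^2\eta^2\ln(1/\tilde\eta_0^2)}\Big(\frac1{\tilde\epsilon}\Big)^{2\ln(\tilde\eta_0^{-1})/\ln(\tilde\eta^{-1})+\delta}+\Big\lceil\ln(1/\tilde\epsilon)\Big(\frac1{\ln(\tilde\eta^{-1})}+\frac{\delta}{2\ln(\tilde\eta_0^{-1})}\Big)\Big\rceil_+ .$$ 4. Consequently, with $\eta=a$ and this $\tilde q$, $\tilde\ell_i(\eta)\le\kappa\,(\sqrt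 N/\epsilon)^{2\ln(\tilde\eta_0^{-1})/\ln(\tilde\eta^{-1})+\delta}$ for all $0<\epsilon\le1$, where $\kappa$ depends only on $a$, $C$, $\delta$, $p_{\min}$, $p_{\max}$ and an upper bound for $Q_i$ (not on $N$, $i$ or $\epsilon$). -/

import Mathlib

open MeasureTheory ProbabilityTheory Set
open scoped BigOperators

namespace StochNash

noncomputable section

/-- The strategy space `ℝ^{n_i}` of player `i`, with its Euclidean norm. -/
abbrev Strat {N : ℕ} (n : Fin N → ℕ) (i : Fin N) : Type := EuclideanSpace ℝ (Fin (n i))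

/-- Strategy profiles `x = (x_1, …, x_N)`. -/
abbrev Profile {N : ℕ} (n : Fin N → ℕ) : Type := (i : Fin N) → Strat n i

/-- The Euclidean norm of the vector `(‖x_1 - y_1‖, …, ‖x_N - y_N‖)`. -/
def profileDist {N : ℕ} {n : Fin N → ℕ} (x y : Profile n) : ℝ :=
  Real.sqrt (∑ i, ‖x i - y i‖ ^ 2)

/-- A Euclidean projection of `u` onto `S` (unique when `S` is nonempty, closed and convex). -/
def proj {E : Type} [NormedAddCommGroup E] (S : Set E) (u : E) : E :=
  Classical.epsilon (fun p => p ∈ S ∧ ‖u - p‖ = Metric.infDist u S)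

/-- The least (real) eigenvalue of a linear operator. -/
def lamMin {E : Type} [NormedAddCommGroup E] [NormedSpace ℝ E] (A : E →L[ℝ] E) : ℝ :=
  sInf {l : ℝ | Module.End.HasEigenvalue (A : E →ₗ[ℝ] E) l}

/-- The data of an `N`-player stochastic Nash game: player `i` has the strategy set
`X i ⊆ ℝ^{n i}` and the sampled cost `ψ i (x; s)`, and `ξ` is the random vector in `ℝ^d`. -/
structure Game (N d : ℕ) (Ω : Type*) where
  n : Fin N → ℕ
  X : (i : Fin N) → Set (Strat n i)
  ψ : (i : Fin N) → Profile n → EuclideanSpace ℝ (Fin d) → ℝ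
  ξ : Ω → EuclideanSpace ℝ (Fin d)

namespace Game

variable {N d : ℕ} {Ω : Type*} [MeasurableSpace Ω]

/-- The set `X = ∏ X_i`. -/
def feasible (G : Game N d Ω) : Set (Profile G.n) := {x | ∀ i, x i ∈ G.X i}

/-- The expected cost `f_i(x) = 𝔼[ψ_i(x; ξ)]`. -/
def f (G : Game N d Ω) (P : Measure Ω) (i : Fin N) (x : Profile G.n) : ℝ :=
  ∫ ω, G.ψ i x (G.ξ ω) ∂P

/-- The partial gradient `∇_{x_i} f_i(x)`. -/
def gradf (G : Game N d Ω) (P : Measure Ω) (i : Fin N) (x : Profile G.n) : Strat G.n i :=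
  gradient (fun z => G.f P i (Function.update x i z)) (x i)

/-- The sampled partial gradient `∇_{x_i} ψ_i(x; s)`. -/
def gradψ (G : Game N d Ω) (i : Fin N) (x : Profile G.n) (s : EuclideanSpace ℝ (Fin d)) :
    Strat G.n i :=
  gradient (fun z => G.ψ i (Function.update x i z) s) (x i)

/-- The second derivative block `∇²_{x_i x_j} f_i(x)`: the derivative of `∇_{x_i} f_i` with
respect to `x_j` (for `j = i` the Hessian of `f_i` in `x_i`). -/
def hess (G : Game N d Ω) (P : Measure Ω) (i j : Fin N) (x : Profile G.n) :
    Strat G.n j →L[ℝ] Strat G.n i :=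
  fderiv ℝ (fun z => G.gradf P i (Function.update x j z)) (x j)

/-- `ζ_{i,min}`. -/
def zetaMin (G : Game N d Ω) (P : Measure Ω) (i : Fin N) : ℝ :=
  ⨅ x : G.feasible, lamMin (G.hess P i i x)

/-- `ζ_{ij,max}`. -/
def zetaMax (G : Game N d Ω) (P : Measure Ω) (i j : Fin N) : ℝ :=
  ⨆ x : G.feasible, ‖G.hess P i j x‖

/-- The matrix `Γ` with diagonal entries `μ / (μ + ζ_{i,min})` and off-diagonal entries
`ζ_{ij,max} / (μ + ζ_{i,min})`. -/
def Gam (G : Game N d Ω) (P : Measure Ω) (mu : ℝ) : Matrix (Fin N) (Fin N) ℝ :=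
  Matrix.of fun i j =>
    if i = j then mu / (mu + G.zetaMin P i) else G.zetaMax P i j / (mu + G.zetaMin P i)

/-- `a = ‖Γ‖`, the spectral norm of `Γ`. -/
def contr (G : Game N d Ω) (P : Measure Ω) (mu : ℝ) : ℝ :=
  ‖Matrix.toEuclideanCLM (𝕜 := ℝ) (G.Gam P mu)‖

/-- `x` is a Nash equilibrium. -/
def IsNash (G : Game N d Ω) (P : Measure Ω) (x : Profile G.n) : Prop :=
  x ∈ G.feasible ∧ ∀ i, ∀ z ∈ G.X i, G.f P i x ≤ G.f P i (Function.update x i z)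

/-- The random profile `x` is an `ε`-NE₂ (with respect to the equilibrium `xs`). -/
def IsEpsNE2 (G : Game N d Ω) (P : Measure Ω) (xs : Profile G.n) (ε : ℝ)
    (x : Ω → Profile G.n) : Prop :=
  Integrable (fun ω => profileDist (x ω) xs) P ∧ ∫ ω, profileDist (x ω) xs ∂P ≤ ε

/-- The proximal best response `x̂_i(y)`: the minimizer of
`f_i(z, y_{-i}) + (μ/2) ‖z - y_i‖²` over `z ∈ X_i`. -/
def proxBR (G : Game N d Ω) (P : Measure Ω) (mu : ℝ) (i : Fin N) (y : Profile G.n) :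
    Strat G.n i :=
  Classical.epsilon (fun z => z ∈ G.X i ∧
    IsMinOn (fun w => G.f P i (Function.update y i w) + mu / 2 * ‖w - y i‖ ^ 2) (G.X i) z)

/-- Standing assumptions on the stochastic game, with second-moment constants `M i`. -/
structure Regular (G : Game N d Ω) (P : Measure Ω) (M : Fin N → ℝ) : Prop where
  measurable_ξ : Measurable G.ξ
  /-- joint measurability of the stochastic gradient oracle on `X × ℝ^d` -/
  measurable_grad : ∀ i, Measurable
    (fun p : G.feasible × EuclideanSpace ℝ (Fin d) => G.gradψ i p.1 p.2)
  isCompact : ∀ i, IsCompact (G.X i)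
  convex : ∀ i, Convex ℝ (G.X i)
  /-- `f_i` is finite, convex and `C²` in `x_i` on an open set containing `X_i` -/
  smooth : ∀ i, ∀ x ∈ G.feasible, ∃ U : Set (Strat G.n i), IsOpen U ∧ G.X i ⊆ U ∧
    (∀ z ∈ U, Integrable (fun ω => G.ψ i (Function.update x i z) (G.ξ ω)) P) ∧
    ConvexOn ℝ U (fun z => G.f P i (Function.update x i z)) ∧
    ContDiffOn ℝ 2 (fun z => G.f P i (Function.update x i z)) U
  /-- the mixed second derivatives exist on `X` -/
  mixed : ∀ i j, j ≠ i → ∀ x ∈ G.feasible,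
    DifferentiableAt ℝ (fun z => G.gradf P i (Function.update x j z)) (x j)
  /-- and are bounded there, so that `ζ_{ij,max}` is finite -/
  mixed_bdd : ∀ i j, j ≠ i → BddAbove (range fun x : G.feasible => ‖G.hess P i j x‖)
  diff_ψ : ∀ i, ∀ x ∈ G.feasible, ∀ ω, ∃ U : Set (Strat G.n i), IsOpen U ∧ G.X i ⊆ U ∧
    DifferentiableOn ℝ (fun z => G.ψ i (Function.update x i z) (G.ξ ω)) U
  unbiased : ∀ i, ∀ x ∈ G.feasible, G.gradf P i x = ∫ ω, G.gradψ i x (G.ξ ω) ∂P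
  M_pos : ∀ i, 0 < M i
  moment : ∀ i, ∀ x ∈ G.feasible, Integrable (fun ω => ‖G.gradψ i x (G.ξ ω)‖ ^ 2) P ∧
    ∫ ω, ‖G.gradψ i x (G.ξ ω)‖ ^ 2 ∂P ≤ M i ^ 2

/-- `Q_i = 2 M_i² / μ² + 2 D_{X_i}²`, with `D_{X_i}` the diameter of `X_i`. -/
def Q (G : Game N d Ω) (mu : ℝ) (M : Fin N → ℝ) (i : Fin N) : ℝ :=
  2 * M i ^ 2 / mu ^ 2 + 2 * Metric.diam (G.X i) ^ 2

/-- The projected stochastic gradient iteration of player `i` for the proximal best response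
problem at `y`, started at `y_i`, with step lengths `γ_t = 1 / (μ (t + 1))`, `t = 1, 2, …`.
`sa … t` is the point obtained after `t` steps (written `z_{i,t+1}` when the starting point is
called `z_{i,1}`), and step number `t + 1` uses the sample `s t`. -/
def sa (G : Game N d Ω) (mu : ℝ) (i : Fin N) (y : Profile G.n)
    (s : ℕ → EuclideanSpace ℝ (Fin d)) : ℕ → Strat G.n i
  | 0 => y i
  | t + 1 =>
    let z := sa G mu i y s t
    proj (G.X i) (z - (1 / (mu * ((t : ℝ) + 2))) •
      (G.gradψ i (Function.update y i z) (s t) + mu • (z - y i)))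

end Game

/-- The randomness that drives the randomized scheme: the initial profile, the activation
indicators `χ_{i,k}` and the samples `ξ_{i,k}^{t+1}` (written `sample i k t`). -/
structure Driver {N d : ℕ} {Ω : Type*} (G : Game N d Ω) where
  x0 : Ω → Profile G.n
  χ : Fin N → ℕ → Ω → Bool
  sample : Fin N → ℕ → ℕ → Ω → EuclideanSpace ℝ (Fin d)

namespace Driver

variable {N d : ℕ} {Ω : Type*} [MeasurableSpace Ω] {G : Game N d Ω}

/-- `β_{i,k}`, the number of updates of player `i` before major iteration `k`. -/
def β (S : Driver G) (i : Fin N) (k : ℕ) (ω : Ω) : ℕ :=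
  ((Finset.range k).filter (fun l => S.χ i l ω = true)).card

/-- The iterates `x_k` of the randomized scheme with stochastic approximation inner solves:
if `χ_{i,k} = 1`, player `i` takes `J i β_{i,k}` projected stochastic gradient steps started at
`x_{i,k}`; otherwise `x_{i,k+1} = x_{i,k}`. -/
def iter (S : Driver G) (mu : ℝ) (J : Fin N → ℕ → ℕ) : ℕ → Ω → Profile G.n
  | 0 => S.x0
  | k + 1 => fun ω i =>
    if S.χ i k ω = true then
      G.sa mu i (iter S mu J k ω) (fun t => S.sample i k t ω) (J i (S.β i k ω))
    else iter S mu J k ω i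

/-- The sample `ξ_{i,k}^{t+1}` where it is used by the scheme, and `0` where it is not drawn. -/
def used (S : Driver G) (J : Fin N → ℕ → ℕ) (i : Fin N) (k t : ℕ) (ω : Ω) :
    EuclideanSpace ℝ (Fin d) :=
  if S.χ i k ω = true ∧ t < J i (S.β i k ω) then S.sample i k t ω else 0

/-- The σ-field `ℱ_k` of the information used up to the update of `x_k`: it is generated by
`x_0`, the indicators `χ_{i,l}` and the samples used at the major iterations `l < k`. -/
@[reducible] def info (S : Driver G) (J : Fin N → ℕ → ℕ) (k : ℕ) : MeasurableSpace Ω :=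
  MeasurableSpace.comap S.x0 inferInstance ⊔
    ⨆ l : Fin k, ⨆ i : Fin N,
      (MeasurableSpace.comap (S.χ i l) inferInstance ⊔
        ⨆ t : ℕ, MeasurableSpace.comap (S.used J i l t) inferInstance)

/-- The number of projected stochastic gradient steps player `i` takes in the major iterations
`0, …, K - 1`. -/
def numSteps (S : Driver G) (J : Fin N → ℕ → ℕ) (i : Fin N) (K : ℕ) (ω : Ω) : ℝ :=
  ∑ k ∈ Finset.range K, if S.χ i k ω = true then (J i (S.β i k ω) : ℝ) else 0

/-- Probabilistic assumptions on the driver. -/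
structure Admissible (S : Driver G) (P : Measure Ω) (J : Fin N → ℕ → ℕ) (p : Fin N → ℝ) :
    Prop where
  measurable_x0 : Measurable S.x0
  measurable_χ : ∀ i k, Measurable (S.χ i k)
  measurable_sample : ∀ i k t, Measurable (S.sample i k t)
  x0_mem : ∀ ω, S.x0 ω ∈ G.feasible
  /-- for each player, the activation indicators are i.i.d. Bernoulli with parameter `p_i > 0` -/
  p_pos : ∀ i, 0 < p i
  χ_law : ∀ i k, P.real {ω | S.χ i k ω = true} = p i
  χ_iid : ∀ i, iIndepFun (fun k => S.χ i k) P
  χ_indep : ∀ i k, Indep (MeasurableSpace.comap (S.χ i k) inferInstance) (S.info J k) P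
  /-- the samples are i.i.d. copies of `ξ`, drawn independently of the past and of the activation -/
  sample_law : ∀ i k t, IdentDistrib (S.sample i k t) G.ξ P P
  sample_iid : ∀ i k, iIndepFun (fun t => S.sample i k t) P
  sample_indep : ∀ i k, Indep (⨆ t : ℕ, MeasurableSpace.comap (S.sample i k t) inferInstance)
    (S.info J k ⊔ MeasurableSpace.comap (S.χ i k) inferInstance) P

end Driver

/-- The step-number rule `m ↦ ⌈Q_i / η^{2(m+1)}⌉`. -/
def stepRule {N : ℕ} (Q : Fin N → ℝ) (η : ℝ) (i : Fin N) (m : ℕ) : ℕ :=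
  ⌈Q i / η ^ (2 * (m + 1))⌉₊

/-- `ã`, with `ã² = 1 - p_min (1 - a²)`. -/
def aTil {N : ℕ} (p : Fin N → ℝ) (a : ℝ) : ℝ := Real.sqrt (1 - (⨅ i, p i) * (1 - a ^ 2))

/-- `η̃`, with `η̃² = 1 - p_min (1 - η²)`. -/
def etaTil {N : ℕ} (p : Fin N → ℝ) (η : ℝ) : ℝ := Real.sqrt (1 - (⨅ i, p i) * (1 - η ^ 2))

/-- `η̃₀`, with `η̃₀⁻² = p_max (η⁻² - 1) + 1`. -/
def etaTil0 {N : ℕ} (p : Fin N → ℝ) (η : ℝ) : ℝ :=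
  (Real.sqrt ((⨆ i, p i) * ((η ^ 2)⁻¹ - 1) + 1))⁻¹

/-- `c̃ = max {ã, η̃}`. -/
def cTil {N : ℕ} (p : Fin N → ℝ) (a η : ℝ) : ℝ := max (aTil p a) (etaTil p η)

/-- `C̃ = C (∑ N⁻¹ p_i⁻¹)^{1/2}`. -/
def bigCTil {N : ℕ} (p : Fin N → ℝ) (C : ℝ) : ℝ :=
  C * Real.sqrt (∑ i, (N : ℝ)⁻¹ * (p i)⁻¹)

/-- `D = 1 / ln((q̃/c̃)^e)`. -/
def bigD {N : ℕ} (p : Fin N → ℝ) (a η q : ℝ) : ℝ :=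
  1 / Real.log ((q / cTil p a η) ^ Real.exp 1)

/-- `D̃ = D η η̃⁻¹`. -/
def bigDTil {N : ℕ} (p : Fin N → ℝ) (a η q : ℝ) : ℝ :=
  bigD p a η q * η * (etaTil p η)⁻¹

/-- `ε̃ = ε / ((N p_max)^{1/2} (C̃ + D̃))`. -/
def epsTil {N : ℕ} (p : Fin N → ℝ) (a η q C ε : ℝ) : ℝ :=
  ε / (Real.sqrt (N * ⨆ i, p i) * (bigCTil p C + bigDTil p a η q))

/-- The bound `ℓ̃_i(η)`. The second summand is `max {⌈ln(1/ε̃) / ln(1/q̃)⌉, 0}`. -/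
def ellTil {N : ℕ} (p : Fin N → ℝ) (i : Fin N) (Q a η q C ε : ℝ) : ℝ :=
  p i * Q / (η ^ 2 * etaTil0 p η ^ 2 * Real.log (1 / etaTil0 p η ^ 2)) *
      (1 / epsTil p a η q C ε) ^ (Real.log (1 / etaTil0 p η ^ 2) / Real.log (1 / q))
    + (⌈Real.log (1 / epsTil p a η q C ε) / Real.log (1 / q)⌉₊ : ℝ)

/-- The choice `q̃ = η̃ e^{δ₀/2}`, `δ₀ = δ ln(η̃⁻¹) / (ln(η̃₀⁻¹)/ln(η̃⁻¹) + δ/2)`. -/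
def qDelta {N : ℕ} (p : Fin N → ℝ) (η δ : ℝ) : ℝ :=
  etaTil p η * Real.exp ((δ * Real.log (etaTil p η)⁻¹ /
    (Real.log (etaTil0 p η)⁻¹ / Real.log (etaTil p η)⁻¹ + δ / 2)) / 2)

/-- The exponent `2 ln(η̃₀⁻¹) / ln(η̃⁻¹) + δ`. -/
def expo {N : ℕ} (p : Fin N → ℝ) (η δ : ℝ) : ℝ :=
  2 * Real.log (etaTil0 p η)⁻¹ / Real.log (etaTil p η)⁻¹ + δ

end

end StochNash

/-! The proximal best response contracts towards the equilibrium. Testing the variational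
inequalities of two proximal problems against each other's solutions bounds `‖x̂_i(y) - x*_i‖` by `∑
j, Γ_ij ‖y_j - x*_j‖` (`Game.ProxVI.norm_sub_le`), so the vector of player distances shrinks by the
factor `a = ‖Γ‖` (`Game.sum_proxBR_sub_sq_le`). The scheme replaces `x̂_i` by `j` SG steps on a
problem of modulus `μ`, with mean square error at most `Q_i / (j + 2)`
(`Game.integral_sa_sub_sq_le`). Since the samples are independent of the past, the iterate and the
step count can be frozen, and the step rule turns this bound into the inexactness `η^(β+1)`.

Random activation is handled by the weighted error `W_k = ∑ p_i⁻¹ E‖x_{i,k} - x*_i‖²`. The weight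
cancels the probability `p_i` of an update, so the best responses enter with equal weights and the
contraction applies; this gives the factor `ã²`. The inexactness averages to at most `η² η̃^(2k)` by
the generating function of the binomial variable `β` (`Driver.integral_pow_β`). The result is
`√W_{k+1} ≤ ã √W_k + √N η η̃^k`, which unrolls to a multiple of `(C̃ + k η/η̃) c̃^k`
(`Driver.sqrt_wmse_le`). The factor `k` is traded for a rate `q̃ > c̃` at the price `D`
(`mul_pow_le_of_lt`), so accuracy `ε` holds from the iteration `K = ⌈ln(1/ε̃)/ln(1/q̃)⌉₊` on.

The same generating function at `η⁻²` bounds the expected work of iteration `k` by a multiple of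
`η̃₀^(-2k)`, up to rounding. Summing this geometric series up to `K` gives the power of `1/ε̃`
(`Driver.integral_numSteps_le`, `sum_pow_ceil_le`). The choice of `q̃` in part 3 makes the exponent
an exact identity (`exponent_qDelta`), and `N` enters `1/ε̃` only through `√N` up to constants,
whence the uniform `κ` (`ellTil_le`). -/

namespace StochNash

/-! ### Euclidean projections -/

section Proj

variable {E : Type} [NormedAddCommGroup E] {S : Set E}

theorem proj_spec (hS : IsCompact S) (hne : S.Nonempty) (u : E) :
    proj S u ∈ S ∧ ‖u - proj S u‖ = Metric.infDist u S := by
  have h : ∃ p, p ∈ S ∧ ‖u - p‖ = Metric.infDist u S := by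
    obtain ⟨p, hp, h⟩ := hS.exists_infDist_eq_dist hne u
    exact ⟨p, hp, by rw [h, dist_eq_norm]⟩
  exact Classical.epsilon_spec h

theorem proj_mem (hS : IsCompact S) (hne : S.Nonempty) (u : E) : proj S u ∈ S :=
  (proj_spec hS hne u).1

variable [InnerProductSpace ℝ E]

theorem inner_proj_le (hS : IsCompact S) (hc : Convex ℝ S) (hne : S.Nonempty) (u : E) {w : E}
    (hw : w ∈ S) : inner ℝ (u - proj S u) (w - proj S u) ≤ 0 := by
  obtain ⟨h1, h2⟩ := proj_spec hS hne u
  refine (norm_eq_iInf_iff_real_inner_le_zero hc h1).1 ?_ w hw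
  rw [h2, Metric.infDist_eq_iInf]
  simp only [dist_eq_norm]

/-- A point satisfying the variational inequality of a projection is nearer to the projection of
`u` than the unprojected point. -/
theorem norm_proj_sub_le (hS : IsCompact S) (hc : Convex ℝ S) (hne : S.Nonempty) (u v : E)
    {w : E} (hw : w ∈ S) (hv : ∀ z ∈ S, inner ℝ (v - w) (z - w) ≤ 0) :
    ‖proj S u - w‖ ≤ ‖u - v‖ := by
  have h1 := inner_proj_le hS hc hne u hw
  have h2 := hv _ (proj_mem hS hne u)
  set p := proj S u
  -- Firm nonexpansiveness: the right side exceeds the left by two terms that are nonnegative by the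
  -- two variational inequalities.
  have h3 : ‖p - w‖ ^ 2 ≤ inner ℝ (u - v) (p - w) := by
    rw [← real_inner_self_eq_norm_sq]
    have e1 : inner ℝ (u - p) (w - p) = -inner ℝ (u - p) (p - w) := by
      rw [← inner_neg_right, neg_sub]
    have e2 : inner ℝ (u - v) (p - w)
        = inner ℝ (u - p) (p - w) + inner ℝ (p - w) (p - w) - inner ℝ (v - w) (p - w) := by
      rw [← inner_add_left, ← inner_sub_left]; congr 1; abel
    linarith
  have h4 := h3.trans (real_inner_le_norm _ _)
  by_contra! hlt
  nlinarith [norm_nonneg (p - w), norm_nonneg (u - v)]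

theorem lipschitzWith_proj (hS : IsCompact S) (hc : Convex ℝ S) (hne : S.Nonempty) :
    LipschitzWith 1 (proj S) :=
  LipschitzWith.of_dist_le_mul fun u v => by
    simpa [dist_eq_norm] using norm_proj_sub_le hS hc hne u v (proj_mem hS hne v)
      fun z hz => inner_proj_le hS hc hne v hz

end Proj

/-! ### Least eigenvalues and convex `C²` functions -/

section Hessian

variable {E : Type} [NormedAddCommGroup E] [InnerProductSpace ℝ E]

/-- In finite dimension the infimum of the Rayleigh quotient of a symmetric operator is itself an
eigenvalue, so `lamMin A` lies below every Rayleigh quotient. -/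
theorem lamMin_mul_norm_sq_le [FiniteDimensional ℝ E] {A : E →L[ℝ] E}
    (hA : (A : E →ₗ[ℝ] E).IsSymmetric) (v : E) :
    lamMin A * ‖v‖ ^ 2 ≤ inner ℝ (A v) v := by
  rcases eq_or_ne v 0 with rfl | hv
  · simp
  have : Nontrivial E := ⟨⟨v, 0, hv⟩⟩
  have hpos : 0 < ‖v‖ ^ 2 := by positivity
  have h1 := hA.hasEigenvalue_iInf_of_finiteDimensional
  -- Needed because the real `sInf` of a set unbounded below is the default value `0`.
  have hbdd : BddBelow {l : ℝ | Module.End.HasEigenvalue (A : E →ₗ[ℝ] E) l} := by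
    refine ⟨-‖A‖, fun l hl => ?_⟩
    obtain ⟨w, hw⟩ := hl.exists_hasEigenvector
    have h2 : A w = l • w := hw.apply_eq_smul
    have h3 := A.le_opNorm w
    rw [h2, norm_smul] at h3
    have h4 := le_of_mul_le_mul_right h3 (norm_pos_iff.2 hw.2)
    exact (abs_le.1 h4).1
  have h5 : lamMin A ≤ inner ℝ (A v) v / ‖v‖ ^ 2 := by
    refine (csInf_le hbdd h1).trans ?_
    refine ciInf_le (f := fun x : {x : E // x ≠ 0} =>
      RCLike.re (inner ℝ ((A : E →ₗ[ℝ] E) x) (x : E)) / ‖(x : E)‖ ^ 2) ?_ ⟨v, hv⟩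
    refine ⟨-‖A‖, ?_⟩
    rintro _ ⟨w, rfl⟩
    have hw : 0 < ‖(w : E)‖ ^ 2 := by have := norm_pos_iff.2 w.2; positivity
    simp only [RCLike.re_to_real, ContinuousLinearMap.coe_coe]
    rw [le_div_iff₀ hw]
    have h6 := abs_real_inner_le_norm (A w) (w : E)
    have h7 := A.le_opNorm (w : E)
    have h8 := (abs_le.1 h6).1
    nlinarith [norm_nonneg (w : E)]
  rwa [le_div_iff₀ hpos] at h5

/-- Dimension zero is included: there is no eigenvalue and the `sInf` is `0`. -/
theorem lamMin_nonneg {A : E →L[ℝ] E} (hA : ∀ v, 0 ≤ inner ℝ (A v) v) : 0 ≤ lamMin A := by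
  refine Real.sInf_nonneg fun l hl => ?_
  obtain ⟨w, hw⟩ := Module.End.HasEigenvalue.exists_hasEigenvector hl
  have h2 : A w = l • w := hw.apply_eq_smul
  have h3 := hA w
  rw [h2, real_inner_smul_left, real_inner_self_eq_norm_sq] at h3
  have : 0 < ‖w‖ ^ 2 := by have := norm_pos_iff.2 hw.2; positivity
  exact nonneg_of_mul_nonneg_left h3 this

variable [CompleteSpace E] {φ : E → ℝ} {U : Set E}

theorem inner_gradient_nonneg_of_isMinOn {S : Set E} (hS : Convex ℝ S) {z : E}
    (hd : DifferentiableAt ℝ φ z) (hz : z ∈ S) (hmin : IsMinOn φ S z) {w : E} (hw : w ∈ S) :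
    0 ≤ inner ℝ (gradient φ z) (w - z) := by
  rw [inner_gradient_left]
  exact hmin.localize.hasFDerivWithinAt_nonneg hd.hasFDerivAt.hasFDerivWithinAt
    (sub_mem_posTangentConeAt_of_segment_subset (hS.segment_subset hz hw))

/-- The Riesz isomorphism as a real linear map from functionals to vectors. -/
noncomputable def rieszVec : StrongDual ℝ E →L[ℝ] E :=
  LinearMap.mkContinuous
    { toFun := fun l => (InnerProductSpace.toDual ℝ E).symm l
      map_add' := fun l m => map_add _ l m
      map_smul' := fun c l => by simp }
    1 (fun l => by simp)

theorem differentiableAt_gradient (hU : IsOpen U) (hφ : ContDiffOn ℝ 2 φ U) {z : E}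
    (hz : z ∈ U) : DifferentiableAt ℝ (gradient φ) z := by
  have h1 : DifferentiableAt ℝ (fderiv ℝ φ) z :=
    ((hφ.contDiffAt (hU.mem_nhds hz)).fderiv_right (m := 1) (by norm_num)).differentiableAt
      (by norm_num)
  exact (rieszVec (E := E)).differentiableAt.comp z h1

theorem inner_fderiv_gradient (hU : IsOpen U) (hφ : ContDiffOn ℝ 2 φ U) {z : E} (hz : z ∈ U)
    (v w : E) : inner ℝ (fderiv ℝ (gradient φ) z v) w = fderiv ℝ (fderiv ℝ φ) z v w := by
  have h1 : DifferentiableAt ℝ (fderiv ℝ φ) z :=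
    ((hφ.contDiffAt (hU.mem_nhds hz)).fderiv_right (m := 1) (by norm_num)).differentiableAt
      (by norm_num)
  have h2 : HasFDerivAt (gradient φ) ((rieszVec (E := E)).comp (fderiv ℝ (fderiv ℝ φ) z)) z :=
    (rieszVec (E := E)).hasFDerivAt.comp z h1.hasFDerivAt
  rw [h2.fderiv]
  simp [rieszVec]

theorem isSymmetric_fderiv_gradient (hU : IsOpen U) (hφ : ContDiffOn ℝ 2 φ U) {z : E}
    (hz : z ∈ U) : (fderiv ℝ (gradient φ) z : E →ₗ[ℝ] E).IsSymmetric := by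
  intro v w
  have h := (hφ.contDiffAt (hU.mem_nhds hz)).isSymmSndFDerivAt (by simp) v w
  simp only [ContinuousLinearMap.coe_coe]
  rw [inner_fderiv_gradient hU hφ hz, real_inner_comm, inner_fderiv_gradient hU hφ hz, h]

theorem hasDerivAt_inner_gradient_line (hU : IsOpen U) (hφ : ContDiffOn ℝ 2 φ U) (z v : E) {t : ℝ}
    (ht : z + t • v ∈ U) :
    HasDerivAt (fun s : ℝ => inner ℝ (gradient φ (z + s • v)) v)
      (inner ℝ (fderiv ℝ (gradient φ) (z + t • v) v) v) t := by
  have h1 : HasDerivAt (fun s : ℝ => z + s • v) v t := by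
    simpa using ((hasDerivAt_id t).smul_const v).const_add z
  have h2 := (differentiableAt_gradient hU hφ ht).hasFDerivAt.comp_hasDerivAt t h1
  simpa using h2.inner ℝ (hasDerivAt_const t v)

/-- Restrict `φ` to the line `t ↦ z + t • v`. A differentiable convex function of one variable has a
monotone derivative, and the derivative of that derivative at `0` is the quadratic form. -/
theorem fderiv_gradient_nonneg (hU : IsOpen U) (hc : ConvexOn ℝ U φ) (hφ : ContDiffOn ℝ 2 φ U)
    {z : E} (hz : z ∈ U) (v : E) : 0 ≤ inner ℝ (fderiv ℝ (gradient φ) z v) v := by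
  set L : ℝ →ᵃ[ℝ] E := AffineMap.lineMap z (z + v)
  have hL : ∀ t : ℝ, L t = z + t • v := fun t => by
    simp [L, AffineMap.lineMap_apply, add_comm]
  have hcont : Continuous fun t : ℝ => z + t • v := by fun_prop
  set V : Set ℝ := L ⁻¹' U
  have hVo : IsOpen V := by
    have : V = (fun t : ℝ => z + t • v) ⁻¹' U := by ext t; simp [V, hL]
    rw [this]; exact hU.preimage hcont
  have hV : ConvexOn ℝ V (φ ∘ L) := hc.comp_affineMap L
  have hder : ∀ t ∈ V, HasDerivAt (φ ∘ L) (inner ℝ (gradient φ (z + t • v)) v) t := by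
    intro t ht
    have ht' : z + t • v ∈ U := by rw [← hL]; exact ht
    have h1 : HasDerivAt (fun s : ℝ => z + s • v) v t := by
      simpa using ((hasDerivAt_id t).smul_const v).const_add z
    have h2 : DifferentiableAt ℝ φ (z + t • v) :=
      (hφ.contDiffAt (hU.mem_nhds ht')).differentiableAt (by norm_num)
    have h3 := h2.hasFDerivAt.comp_hasDerivAt t h1
    rw [inner_gradient_left]
    have : (φ ∘ L) = φ ∘ fun s : ℝ => z + s • v := by ext s; simp [hL]
    rw [this]; exact h3
  have hmono := hV.monotoneOn_deriv fun t ht => (hder t ht).differentiableAt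
  have hmono' : MonotoneOn (fun t : ℝ => inner ℝ (gradient φ (z + t • v)) v) V :=
    hmono.congr fun t ht => (hder t ht).deriv
  have h0 : (0 : ℝ) ∈ V := by simpa [V, hL] using hz
  have h := hmono'.derivWithin_nonneg (x := 0)
  have hd := hasDerivAt_inner_gradient_line hU hφ z v (t := 0) (by simpa using hz)
  rw [hd.hasDerivWithinAt.derivWithin (hVo.uniqueDiffWithinAt h0)] at h
  simpa using h

/-- Strong monotonicity of the gradient on a convex set where the least eigenvalue of the Hessian
is at least `c`. -/
theorem le_inner_gradient_sub [FiniteDimensional ℝ E] (hU : IsOpen U) (hφ : ContDiffOn ℝ 2 φ U)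
    {S : Set E}
    (hS : Convex ℝ S) (hSU : S ⊆ U) {c : ℝ} (hc : ∀ z ∈ S, c ≤ lamMin (fderiv ℝ (gradient φ) z))
    {z w : E} (hz : z ∈ S) (hw : w ∈ S) :
    c * ‖z - w‖ ^ 2 ≤ inner ℝ (gradient φ z - gradient φ w) (z - w) := by
  have hseg : ∀ t ∈ Icc (0 : ℝ) 1, w + t • (z - w) ∈ S := fun t ht =>
    hS.add_smul_sub_mem hw hz ht
  have hd : ∀ t ∈ Icc (0 : ℝ) 1, HasDerivAt
      (fun s : ℝ => inner ℝ (gradient φ (w + s • (z - w))) (z - w))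
      (inner ℝ (fderiv ℝ (gradient φ) (w + t • (z - w)) (z - w)) (z - w)) t := fun t ht =>
    hasDerivAt_inner_gradient_line hU hφ w (z - w) (hSU (hseg t ht))
  -- Mean value inequality for the directional derivative along the segment from `w` to `z`, whose
  -- slope is the Hessian form at an intermediate point.
  have h := (convex_Icc (0 : ℝ) 1).mul_sub_le_image_sub_of_le_deriv
    (f := fun s : ℝ => inner ℝ (gradient φ (w + s • (z - w))) (z - w)) (C := c * ‖z - w‖ ^ 2)
    (fun t ht => (hd t ht).continuousAt.continuousWithinAt)
    (fun t ht => (hd t (interior_subset ht)).differentiableAt.differentiableWithinAt)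
    (fun t ht => by
      have ht' := interior_subset ht
      rw [(hd t ht').deriv]
      refine le_trans ?_ (lamMin_mul_norm_sq_le
        (isSymmetric_fderiv_gradient hU hφ (hSU (hseg t ht'))) _)
      exact mul_le_mul_of_nonneg_right (hc _ (hseg t ht')) (by positivity))
    0 (by simp) 1 (by simp) zero_le_one
  simpa [inner_sub_left (𝕜 := ℝ) (gradient φ z) (gradient φ w), -inner_gradient_left] using h

end Hessian

/-! ### Proximal best responses -/

namespace Game

variable {N d : ℕ} {Ω : Type*} {G : Game N d Ω}

theorem update_mem_feasible {x : Profile G.n} (hx : x ∈ G.feasible) {i : Fin N}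
    {z : Strat G.n i} (hz : z ∈ G.X i) : Function.update x i z ∈ G.feasible := by
  intro j
  rcases eq_or_ne j i with rfl | h
  · simpa using hz
  · simpa [h] using hx j

variable [MeasurableSpace Ω] {P : Measure Ω} {M : Fin N → ℝ} {mu : ℝ}

theorem gradf_update (i : Fin N) (x : Profile G.n) (z : Strat G.n i) :
    G.gradf P i (Function.update x i z)
      = gradient (fun w => G.f P i (Function.update x i w)) z := by
  simp [gradf]

theorem hess_self_update (i : Fin N) (x : Profile G.n) (z : Strat G.n i) :
    G.hess P i i (Function.update x i z)
      = fderiv ℝ (gradient (fun w => G.f P i (Function.update x i w))) z := by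
  simp only [hess, Function.update_idem, Function.update_self]
  congr 1
  ext1 w
  rw [gradf_update]

theorem hess_psd (hR : G.Regular P M) (i : Fin N) {x : Profile G.n} (hx : x ∈ G.feasible)
    (v : Strat G.n i) : 0 ≤ inner ℝ (G.hess P i i x v) v := by
  obtain ⟨U, hU, hXU, -, hc, hφ⟩ := hR.smooth i x hx
  have h := fderiv_gradient_nonneg hU hc hφ (hXU (hx i)) v
  rwa [← hess_self_update, Function.update_eq_self] at h

theorem zetaMin_nonneg (hR : G.Regular P M) (i : Fin N) : 0 ≤ G.zetaMin P i :=
  Real.iInf_nonneg fun x => lamMin_nonneg (hess_psd hR i x.2)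

theorem zetaMin_le (hR : G.Regular P M) (i : Fin N) {x : Profile G.n} (hx : x ∈ G.feasible) :
    G.zetaMin P i ≤ lamMin (G.hess P i i x) :=
  ciInf_le (f := fun x : G.feasible => lamMin (G.hess P i i x))
    ⟨0, by rintro _ ⟨y, rfl⟩; exact lamMin_nonneg (hess_psd hR i y.2)⟩ ⟨x, hx⟩

theorem zetaMin_mul_le_inner_gradf (hR : G.Regular P M) (i : Fin N) {x : Profile G.n}
    (hx : x ∈ G.feasible) {z w : Strat G.n i} (hz : z ∈ G.X i) (hw : w ∈ G.X i) :
    G.zetaMin P i * ‖z - w‖ ^ 2 ≤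
      inner ℝ (G.gradf P i (Function.update x i z) - G.gradf P i (Function.update x i w))
        (z - w) := by
  obtain ⟨U, hU, hXU, -, hc, hφ⟩ := hR.smooth i x hx
  rw [gradf_update, gradf_update]
  refine le_inner_gradient_sub hU hφ (hR.convex i) hXU (fun u hu => ?_) hz hw
  rw [← hess_self_update]
  exact zetaMin_le hR i (update_mem_feasible hx hu)

theorem norm_gradf_update_sub_le (hR : G.Regular P M) {i j : Fin N} (hji : j ≠ i)
    {x : Profile G.n} (hx : x ∈ G.feasible) {u v : Strat G.n j} (hu : u ∈ G.X j)
    (hv : v ∈ G.X j) :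
    ‖G.gradf P i (Function.update x j u) - G.gradf P i (Function.update x j v)‖ ≤
      G.zetaMax P i j * ‖u - v‖ := by
  refine (hR.convex j).norm_image_sub_le_of_norm_fderiv_le
    (f := fun z => G.gradf P i (Function.update x j z)) (𝕜 := ℝ) (fun z hz => ?_)
    (fun z hz => ?_) hv hu
  · simpa using hR.mixed i j hji _ (update_mem_feasible hx hz)
  · have h := le_ciSup (hR.mixed_bdd i j hji) ⟨_, update_mem_feasible hx hz⟩
    simpa [hess, zetaMax] using h

/-- Pass from `y` to `x` one player at a time through the hybrid profiles `s.piecewise x y`. Each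
change of a player `j ≠ i` costs one mixed-derivative bound; the change of player `i` is void since
`x i = y i`. -/
theorem norm_gradf_sub_le (hR : G.Regular P M) (i : Fin N) {x y : Profile G.n}
    (hx : x ∈ G.feasible) (hy : y ∈ G.feasible) (hxy : x i = y i) :
    ‖G.gradf P i x - G.gradf P i y‖ ≤
      ∑ j, if i = j then 0 else G.zetaMax P i j * ‖x j - y j‖ := by
  have key : ∀ s : Finset (Fin N), ‖G.gradf P i (s.piecewise x y) - G.gradf P i y‖ ≤
      ∑ j ∈ s, if i = j then 0 else G.zetaMax P i j * ‖x j - y j‖ := by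
    intro s
    induction s using Finset.induction_on with
    | empty => simp
    | insert j s hj ih =>
      rw [Finset.sum_insert hj, Finset.piecewise_insert]
      have hs : s.piecewise x y ∈ G.feasible := fun k => by
        by_cases hk : k ∈ s
        · simpa [hk] using hx k
        · simpa [hk] using hy k
      have hyj : s.piecewise x y j = y j := by simp [hj]
      have hself : s.piecewise x y = Function.update (s.piecewise x y) j (y j) := by
        rw [← hyj, Function.update_eq_self]
      have h1 : ‖G.gradf P i (Function.update (s.piecewise x y) j (x j))
          - G.gradf P i (s.piecewise x y)‖ ≤
          if i = j then 0 else G.zetaMax P i j * ‖x j - y j‖ := by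
        split_ifs with hij
        · subst hij
          rw [hxy, ← hself]; simp
        · conv_lhs => rw [hself]
          rw [Function.update_idem]
          exact norm_gradf_update_sub_le hR (Ne.symm hij) hs (hx j) (hy j)
      calc _ ≤ _ := norm_sub_le_norm_sub_add_norm_sub _ (G.gradf P i (s.piecewise x y)) _
        _ ≤ _ := add_le_add h1 ih
  simpa using key Finset.univ

/-- The variational inequality of the proximal problem of player `i` at `y`. -/
def ProxVI (G : Game N d Ω) (P : Measure Ω) (mu : ℝ) (i : Fin N) (y : Profile G.n)
    (z : Strat G.n i) : Prop :=
  z ∈ G.X i ∧ ∀ w ∈ G.X i,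
    0 ≤ inner ℝ (G.gradf P i (Function.update y i z) + mu • (z - y i)) (w - z)

theorem differentiableAt_f (hR : G.Regular P M) (i : Fin N) {y : Profile G.n}
    (hy : y ∈ G.feasible) {z : Strat G.n i} (hz : z ∈ G.X i) :
    DifferentiableAt ℝ (fun w => G.f P i (Function.update y i w)) z := by
  obtain ⟨U, hU, hXU, -, -, hφ⟩ := hR.smooth i y hy
  exact (hφ.contDiffAt (hU.mem_nhds (hXU hz))).differentiableAt (by norm_num)

theorem proxBR_spec (hR : G.Regular P M) (i : Fin N) {y : Profile G.n} (hy : y ∈ G.feasible) :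
    G.proxBR P mu i y ∈ G.X i ∧
      IsMinOn (fun w => G.f P i (Function.update y i w) + mu / 2 * ‖w - y i‖ ^ 2) (G.X i)
        (G.proxBR P mu i y) := by
  have hcont : ContinuousOn
      (fun w => G.f P i (Function.update y i w) + mu / 2 * ‖w - y i‖ ^ 2) (G.X i) := by
    refine ContinuousOn.add (fun z hz =>
      (differentiableAt_f hR i hy hz).continuousAt.continuousWithinAt) ?_
    fun_prop
  obtain ⟨z, hz, hmin⟩ := (hR.isCompact i).exists_isMinOn ⟨y i, hy i⟩ hcont
  exact Classical.epsilon_spec (p := fun z => z ∈ G.X i ∧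
    IsMinOn (fun w => G.f P i (Function.update y i w) + mu / 2 * ‖w - y i‖ ^ 2) (G.X i) z)
    ⟨z, hz, hmin⟩

theorem proxVI_proxBR (hR : G.Regular P M) (i : Fin N) {y : Profile G.n}
    (hy : y ∈ G.feasible) : G.ProxVI P mu i y (G.proxBR P mu i y) := by
  obtain ⟨hz, hmin⟩ := proxBR_spec (mu := mu) hR i hy
  set z := G.proxBR P mu i y
  refine ⟨hz, fun w hw => ?_⟩
  have hd := differentiableAt_f hR i hy hz
  have h1 := ((hasFDerivAt_id (𝕜 := ℝ) z).sub_const (y i)).norm_sq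
  have h2 := hd.hasFDerivAt.add (h1.const_mul (mu / 2))
  have h3 := inner_gradient_nonneg_of_isMinOn (hR.convex i) h2.differentiableAt hz hmin hw
  rw [inner_gradient_left] at h3
  erw [h2.fderiv] at h3
  rw [gradf_update, inner_add_left, inner_gradient_left, real_inner_smul_left]
  simp at h3
  simp only [map_sub, inner_sub_left, inner_sub_right] at h3 ⊢
  linarith

/-- The gradient of the proximal term vanishes at the prox centre, so an equilibrium is a fixed
point of the proximal best response. -/
theorem proxVI_of_isNash (hR : G.Regular P M) {xs : Profile G.n} (hxs : G.IsNash P xs)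
    (i : Fin N) : G.ProxVI P mu i xs (xs i) := by
  refine ⟨hxs.1 i, fun w hw => ?_⟩
  have h := inner_gradient_nonneg_of_isMinOn (hR.convex i)
    (differentiableAt_f hR i hxs.1 (hxs.1 i)) (hxs.1 i)
    (fun z hz => by simpa using hxs.2 i z hz) hw
  rw [← gradf_update] at h
  simpa using h

/-- Add the two inequalities, each tested at the other solution. Strong monotonicity with modulus `μ
+ ζ_min` bounds one side below. What remains is the shift of the prox centre and the change of the
gradient with the rivals' strategies; Cauchy–Schwarz and one cancelled factor `‖z - z'‖` give the
row of `Γ`. -/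
theorem ProxVI.norm_sub_le (hR : G.Regular P M) (hmu : 0 < mu) {i : Fin N} {y y' : Profile G.n}
    (hy : y ∈ G.feasible) (hy' : y' ∈ G.feasible) {z z' : Strat G.n i}
    (hz : G.ProxVI P mu i y z) (hz' : G.ProxVI P mu i y' z') :
    ‖z - z'‖ ≤ ∑ j, G.Gam P mu i j * ‖y j - y' j‖ := by
  have hpos : 0 < mu + G.zetaMin P i := add_pos_of_pos_of_nonneg hmu (zetaMin_nonneg hR i)
  have h1 := hz.2 z' hz'.1
  have h2 := hz'.2 z hz.1
  have h3 := zetaMin_mul_le_inner_gradf hR i hy hz.1 hz'.1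
  set g := G.gradf P i (Function.update y i z)
  set g1 := G.gradf P i (Function.update y i z')
  set g' := G.gradf P i (Function.update y' i z')
  set s := ∑ j, if i = j then 0 else G.zetaMax P i j * ‖y j - y' j‖
  have h4 : ‖g' - g1‖ ≤ s := by
    rw [norm_sub_rev]
    refine (norm_gradf_sub_le hR i (update_mem_feasible hy hz'.1)
      (update_mem_feasible hy' hz'.1) (by simp)).trans (Finset.sum_le_sum fun j _ => ?_)
    split_ifs with hij
    · exact le_rfl
    · simp [Function.update_of_ne (Ne.symm hij)]
  have h5 := (real_inner_le_norm (g' - g1) (z - z')).trans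
    (mul_le_mul_of_nonneg_right h4 (norm_nonneg _))
  have h6 := real_inner_le_norm (y i - y' i) (z - z')
  have h7 := real_inner_self_eq_norm_sq (z - z')
  have h8 : (mu + G.zetaMin P i) * ‖z - z'‖ ^ 2 ≤ (mu * ‖y i - y' i‖ + s) * ‖z - z'‖ := by
    have e1 : inner ℝ (g + mu • (z - y i)) (z' - z) + inner ℝ (g' + mu • (z' - y' i)) (z - z')
        = -inner ℝ (g - g1) (z - z') + inner ℝ (g' - g1) (z - z')
          - mu * inner ℝ (z - z') (z - z') + mu * inner ℝ (y i - y' i) (z - z') := by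
      simp only [inner_add_left, inner_sub_left, inner_sub_right, real_inner_smul_left]
      ring
    nlinarith [mul_le_mul_of_nonneg_left h6 hmu.le]
  have h9 : (mu + G.zetaMin P i) * ‖z - z'‖ ≤ mu * ‖y i - y' i‖ + s := by
    rcases (norm_nonneg (z - z')).eq_or_lt with h0 | h0
    · rw [← h0, mul_zero]
      exact add_nonneg (by positivity) ((norm_nonneg _).trans h4)
    · refine le_of_mul_le_mul_right ?_ h0
      rw [mul_assoc, ← sq]; exact h8
  have h10 : ∑ j, G.Gam P mu i j * ‖y j - y' j‖
      = (mu * ‖y i - y' i‖ + s) / (mu + G.zetaMin P i) := by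
    have : mu * ‖y i - y' i‖ = ∑ j, if i = j then mu * ‖y j - y' j‖ else 0 := by simp
    rw [this, ← Finset.sum_add_distrib, Finset.sum_div]
    refine Finset.sum_congr rfl fun j _ => ?_
    simp only [Gam, Matrix.of_apply]
    split_ifs <;> ring
  rw [h10, le_div_iff₀ hpos]
  linarith

theorem contr_nonneg : 0 ≤ G.contr P mu := norm_nonneg _

/-- The distances after the best response are dominated entrywise by `Γ v`, where `v` collects the
distances before it; the operator norm of `Γ` does the rest. -/
theorem sum_proxBR_sub_sq_le (hR : G.Regular P M) (hmu : 0 < mu) {xs : Profile G.n}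
    (hxs : G.IsNash P xs) {y : Profile G.n} (hy : y ∈ G.feasible) :
    ∑ i, ‖G.proxBR P mu i y - xs i‖ ^ 2 ≤ G.contr P mu ^ 2 * ∑ i, ‖y i - xs i‖ ^ 2 := by
  set v : EuclideanSpace ℝ (Fin N) := WithLp.toLp 2 fun j => ‖y j - xs j‖
  have h1 := (Matrix.toEuclideanCLM (𝕜 := ℝ) (G.Gam P mu)).le_opNorm v
  have h2 := pow_le_pow_left₀ (norm_nonneg _) h1 2
  rw [mul_pow, EuclideanSpace.norm_sq_eq, EuclideanSpace.norm_sq_eq] at h2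
  refine le_trans (Finset.sum_le_sum fun i _ => ?_) (h2.trans (le_of_eq ?_))
  · refine pow_le_pow_left₀ (norm_nonneg _) (((proxVI_proxBR hR i hy).norm_sub_le hR hmu hy hxs.1
      (proxVI_of_isNash hR hxs i)).trans ?_) 2
    refine le_trans (le_of_eq ?_) (le_abs_self _)
    simp [v, Matrix.mulVec, dotProduct]
  · simp [v, contr]

/-- Serves only to make the best response at a random profile measurable. -/
theorem continuous_proxBR (hR : G.Regular P M) (hmu : 0 < mu) (i : Fin N) :
    Continuous fun y : G.feasible => G.proxBR P mu i y := by
  rw [continuous_iff_continuousAt]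
  intro y
  rw [ContinuousAt, tendsto_iff_norm_sub_tendsto_zero]
  refine squeeze_zero (fun _ => norm_nonneg _) (fun y' =>
    (proxVI_proxBR hR i y'.2).norm_sub_le hR hmu y'.2 y.2 (proxVI_proxBR hR i y.2)) ?_
  have hc : Continuous fun y' : G.feasible =>
      ∑ j, G.Gam P mu i j * ‖(y' : Profile G.n) j - (y : Profile G.n) j‖ :=
    continuous_finsetSum _ fun j _ => continuous_const.mul
      (((continuous_apply j).comp continuous_subtype_val).sub continuous_const).norm
  simpa using hc.tendsto y

end Game

/-! ### Integrating out an independent variable -/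

section Independence

variable {Ω α β : Type*} {m m0 : MeasurableSpace Ω} [MeasurableSpace α] [MeasurableSpace β]
  {P : Measure Ω} [IsProbabilityMeasure P]

/-- By independence the joint law is a product, so Fubini allows `Y` to be frozen at `y` while `S`
is integrated. -/
theorem integral_le_of_indepFun {Y : Ω → α} {S : Ω → β} (hY : Measurable Y) (hS : Measurable S)
    (hYS : IndepFun Y S P) {Φ : α × β → ℝ} (hΦ : Measurable Φ) {B : ℝ} (hB : ∀ q, ‖Φ q‖ ≤ B)
    {h : α → ℝ} (hh : Measurable h) (hint : Integrable (fun ω => h (Y ω)) P)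
    (hle : ∀ y, ∫ ω, Φ (y, S ω) ∂P ≤ h y) :
    ∫ ω, Φ (Y ω, S ω) ∂P ≤ ∫ ω, h (Y ω) ∂P := by
  have e := (indepFun_iff_map_prod_eq_prod_map_map hY.aemeasurable hS.aemeasurable).1 hYS
  have := Measure.isProbabilityMeasure_map (μ := P) hY.aemeasurable
  have := Measure.isProbabilityMeasure_map (μ := P) hS.aemeasurable
  have hΦi : Integrable Φ ((P.map Y).prod (P.map S)) :=
    Integrable.of_bound hΦ.aestronglyMeasurable B (Filter.Eventually.of_forall hB)
  have e1 : ∫ ω, Φ (Y ω, S ω) ∂P = ∫ y, ∫ ω, Φ (y, S ω) ∂P ∂(P.map Y) := by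
    rw [← integral_map (φ := fun ω => (Y ω, S ω)) (hY.prodMk hS).aemeasurable
      hΦ.aestronglyMeasurable, e, integral_prod _ hΦi]
    refine integral_congr_ae (Filter.Eventually.of_forall fun y => ?_)
    exact integral_map hS.aemeasurable (hΦ.comp measurable_prodMk_left).aestronglyMeasurable
  rw [e1, ← integral_map hY.aemeasurable hh.aestronglyMeasurable]
  refine integral_mono ?_ ?_ hle
  · refine hΦi.integral_prod_left.congr (Filter.Eventually.of_forall fun y => ?_)
    exact integral_map hS.aemeasurable (hΦ.comp measurable_prodMk_left).aestronglyMeasurable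
  · exact (integrable_map_measure hh.aestronglyMeasurable hY.aemeasurable).2 hint

theorem setIntegral_le_of_indep (hm : m ≤ m0) {Y : Ω → α} {S : Ω → β}
    (hY : Measurable[m] Y) (hS : Measurable S)
    (hYS : Indep (MeasurableSpace.comap S inferInstance) m P)
    {Φ : α × β → ℝ} (hΦ : Measurable Φ) {B : ℝ} (hB : ∀ q, ‖Φ q‖ ≤ B)
    {h : α → ℝ} (hh : Measurable h) (hint : Integrable (fun ω => h (Y ω)) P)
    (hle : ∀ y, ∫ ω, Φ (y, S ω) ∂P ≤ h y) {A : Set Ω} (hA : MeasurableSet[m] A) :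
    ∫ ω in A, Φ (Y ω, S ω) ∂P ≤ ∫ ω in A, h (Y ω) ∂P := by
  classical
  -- The event is adjoined to `Y` as a Boolean coordinate. The pair is still `m`-measurable, hence
  -- independent of `S`, and the unrestricted lemma applies.
  set Z : Ω → α × Bool := fun ω => (Y ω, if ω ∈ A then true else false)
  have hZm : Measurable[m] Z := hY.prodMk (Measurable.ite hA measurable_const measurable_const)
  have hZ : Measurable Z := hZm.mono hm le_rfl
  have hZS : IndepFun Z S P := by
    rw [IndepFun_iff_Indep]
    exact (indep_of_indep_of_le_right hYS hZm.comap_le).symm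
  have hmt : MeasurableSet {y : α × Bool | y.2 = true} :=
    measurable_snd (measurableSet_singleton true)
  have hA0 := hm A hA
  have key := integral_le_of_indepFun (P := P) hZ hS hZS
    (Φ := fun q => if q.1.2 = true then Φ (q.1.1, q.2) else 0)
    (Measurable.ite (measurable_fst hmt) (hΦ.comp (by fun_prop)) measurable_const) (B := B)
    (fun q => by
      split_ifs
      · exact hB _
      · rw [norm_zero]; exact (norm_nonneg _).trans (hB (q.1.1, q.2)))
    (h := fun y => if y.2 = true then h y.1 else 0)
    (Measurable.ite hmt (hh.comp measurable_fst) measurable_const)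
    (by
      refine (hint.indicator hA0).congr (Filter.Eventually.of_forall fun ω => ?_)
      by_cases hω : ω ∈ A <;> simp [Z, hω])
    (fun y => by
      rcases y with ⟨y, b⟩
      cases b
      · simp
      · simpa using hle y)
  rw [← integral_indicator hA0, ← integral_indicator hA0]
  convert key using 2 <;>
  · ext ω
    by_cases hω : ω ∈ A <;> simp [Z, hω]

end Independence

/-! ### The projected stochastic gradient method -/

namespace Game

section

variable {N d : ℕ} {Ω : Type*} {G : Game N d Ω} {mu : ℝ}

theorem measurable_update_subtype (i : Fin N) :
    Measurable fun q : G.feasible × G.X i =>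
      (⟨Function.update (q.1 : Profile G.n) i q.2, update_mem_feasible q.1.2 q.2.2⟩ :
        G.feasible) := by
  refine Measurable.subtype_mk ?_
  exact measurable_update'.comp
    ((measurable_subtype_coe.comp measurable_fst).prodMk
      (measurable_subtype_coe.comp measurable_snd))

/-- One projected stochastic gradient step with step length `γ`, as a function of the profile, the
current point and the sample. -/
noncomputable def sgStep (G : Game N d Ω) (mu γ : ℝ) (i : Fin N) (y : Profile G.n)
    (z : Strat G.n i) (s : EuclideanSpace ℝ (Fin d)) : Strat G.n i :=
  proj (G.X i) (z - γ • (G.gradψ i (Function.update y i z) s + mu • (z - y i)))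

theorem sa_succ (i : Fin N) (y : Profile G.n) (s : ℕ → EuclideanSpace ℝ (Fin d)) (t : ℕ) :
    G.sa mu i y s (t + 1)
      = G.sgStep mu (1 / (mu * ((t : ℝ) + 2))) i y (G.sa mu i y s t) (s t) := rfl

/-- Dependence on the first `t` samples only: this makes the next sample independent of the current
point, and lets undrawn samples be replaced by `0`. -/
theorem sa_congr (i : Fin N) (y : Profile G.n) {s s' : ℕ → EuclideanSpace ℝ (Fin d)} (t : ℕ)
    (h : ∀ u < t, s u = s' u) : G.sa mu i y s t = G.sa mu i y s' t := by
  induction t with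
  | zero => rfl
  | succ t ih =>
    simp only [sa]
    rw [ih fun u hu => h u (hu.trans t.lt_succ_self), h t t.lt_succ_self]

end

variable {N d : ℕ} {Ω : Type*} [MeasurableSpace Ω] {G : Game N d Ω} {P : Measure Ω}
  {M : Fin N → ℝ} {mu : ℝ}

theorem sa_mem (hR : G.Regular P M) (i : Fin N) {y : Profile G.n} (hy : y ∈ G.feasible)
    (s : ℕ → EuclideanSpace ℝ (Fin d)) (t : ℕ) : G.sa mu i y s t ∈ G.X i := by
  cases t with
  | zero => exact hy i
  | succ t => exact proj_mem (hR.isCompact i) ⟨_, hy i⟩ _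

theorem measurable_sgStep (hR : G.Regular P M) (i : Fin N) (hne : (G.X i).Nonempty) (γ : ℝ) :
    Measurable fun q : (G.feasible × G.X i) × EuclideanSpace ℝ (Fin d) =>
      G.sgStep mu γ i q.1.1 q.1.2 q.2 := by
  refine (lipschitzWith_proj (hR.isCompact i) (hR.convex i) hne).continuous.measurable.comp ?_
  have h1 : Measurable fun q : (G.feasible × G.X i) × EuclideanSpace ℝ (Fin d) =>
      G.gradψ i (Function.update (q.1.1 : Profile G.n) i q.1.2) q.2 :=
    (hR.measurable_grad i).comp
      (((measurable_update_subtype i).comp measurable_fst).prodMk measurable_snd)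
  have h2 : Measurable fun q : (G.feasible × G.X i) × EuclideanSpace ℝ (Fin d) =>
      (q.1.2 : Strat G.n i) :=
    measurable_subtype_coe.comp (measurable_snd.comp measurable_fst)
  have h3 : Measurable fun q : (G.feasible × G.X i) × EuclideanSpace ℝ (Fin d) =>
      (q.1.1 : Profile G.n) i :=
    (measurable_pi_apply i).comp (measurable_subtype_coe.comp (measurable_fst.comp measurable_fst))
  exact h2.sub ((h1.add ((h2.sub h3).const_smul mu)).const_smul γ)

theorem measurable_sa (hR : G.Regular P M) (i : Fin N) (t : ℕ) :
    Measurable fun q : G.feasible × (ℕ → EuclideanSpace ℝ (Fin d)) =>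
      G.sa mu i q.1 q.2 t := by
  -- A feasible profile supplies the nonempty `X i` required by the projection lemmas; without one
  -- the domain is empty.
  rcases isEmpty_or_nonempty G.feasible with he | ⟨⟨y, hy⟩⟩
  · exact measurable_of_empty _
  induction t with
  | zero =>
    exact (measurable_pi_apply i).comp (measurable_subtype_coe.comp measurable_fst)
  | succ t ih =>
    have h1 : Measurable fun q : G.feasible × (ℕ → EuclideanSpace ℝ (Fin d)) =>
        (⟨G.sa mu i q.1 q.2 t, sa_mem hR i q.1.2 q.2 t⟩ : G.X i) := ih.subtype_mk
    have h2 : Measurable fun q : G.feasible × (ℕ → EuclideanSpace ℝ (Fin d)) =>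
        ((q.1, (⟨G.sa mu i q.1 q.2 t, sa_mem hR i q.1.2 q.2 t⟩ : G.X i)), q.2 t) :=
      (measurable_fst.prodMk h1).prodMk ((measurable_pi_apply t).comp measurable_snd)
    simp_rw [sa_succ]
    have h3 := measurable_sgStep (mu := mu) hR i ⟨y i, hy i⟩ (1 / (mu * ((t : ℝ) + 2)))
    have h4 := h3.comp h2
    exact h4

theorem norm_sub_le_diam (hR : G.Regular P M) (i : Fin N) {z w : Strat G.n i} (hz : z ∈ G.X i)
    (hw : w ∈ G.X i) : ‖z - w‖ ≤ Metric.diam (G.X i) := by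
  rw [← dist_eq_norm]
  exact Metric.dist_le_diam_of_mem (hR.isCompact i).isBounded hz hw

theorem norm_sub_sq_le_diam (hR : G.Regular P M) (i : Fin N) {z w : Strat G.n i}
    (hz : z ∈ G.X i) (hw : w ∈ G.X i) : ‖z - w‖ ^ 2 ≤ Metric.diam (G.X i) ^ 2 :=
  pow_le_pow_left₀ (norm_nonneg _) (norm_sub_le_diam hR i hz hw) 2

theorem Q_pos (hR : G.Regular P M) (hmu : 0 < mu) (i : Fin N) : 0 < G.Q mu M i := by
  have := hR.M_pos i
  rw [Q]; positivity

/-- The modulus comes from the proximal term alone; of `f_i` only the monotonicity of the gradient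
is kept. -/
theorem mul_norm_sq_le_inner_of_proxVI (hR : G.Regular P M) (i : Fin N) {y : Profile G.n}
    (hy : y ∈ G.feasible) {b z : Strat G.n i} (hb : G.ProxVI P mu i y b) (hz : z ∈ G.X i) :
    mu * ‖z - b‖ ^ 2 ≤
      inner ℝ (G.gradf P i (Function.update y i z) + mu • (z - y i)) (z - b) := by
  have h1 := hb.2 z hz
  have h2 := zetaMin_mul_le_inner_gradf hR i hy hz hb.1
  have h3 : 0 ≤ G.zetaMin P i * ‖z - b‖ ^ 2 := mul_nonneg (zetaMin_nonneg hR i) (by positivity)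
  rw [← real_inner_self_eq_norm_sq]
  simp only [inner_add_left, inner_sub_left, real_inner_smul_left] at h1 h2 ⊢
  linarith

variable [IsProbabilityMeasure P]

theorem integrable_gradψ (hR : G.Regular P M) (i : Fin N) {x : Profile G.n}
    (hx : x ∈ G.feasible) : Integrable (fun ω => G.gradψ i x (G.ξ ω)) P := by
  have hm : Measurable fun ω => G.gradψ i x (G.ξ ω) :=
    (hR.measurable_grad i).comp
      ((measurable_const (a := (⟨x, hx⟩ : G.feasible))).prodMk hR.measurable_ξ)
  have h2 : MemLp (fun ω => G.gradψ i x (G.ξ ω)) 2 P :=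
    (memLp_two_iff_integrable_sq_norm hm.aestronglyMeasurable).2 (hR.moment i x hx).1
  exact h2.integrable (by norm_num)

/-- Expand the square after dropping the projection. In expectation the cross term is at most
`-2γμ‖z - b‖²`, and the quadratic term at most `2γ²(M² + μ²D²)`; with `γ = 1/(μ r)` these are the
two terms of the bound. -/
theorem integral_sgStep_le (hR : G.Regular P M) (hmu : 0 < mu) (i : Fin N) {y : Profile G.n}
    (hy : y ∈ G.feasible) {b z : Strat G.n i} (hb : G.ProxVI P mu i y b) (hz : z ∈ G.X i)
    (r : ℝ) (hr : 0 < r) :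
    ∫ ω, ‖G.sgStep mu (1 / (mu * r)) i y z (G.ξ ω) - b‖ ^ 2 ∂P ≤
      (1 - 2 / r) * ‖z - b‖ ^ 2 + G.Q mu M i / r ^ 2 := by
  set x := Function.update y i z with hxdef
  have hx : x ∈ G.feasible := update_mem_feasible hy hz
  set γ := 1 / (mu * r) with hγ
  have hγ0 : 0 < γ := by positivity
  set D := Metric.diam (G.X i)
  have hg := integrable_gradψ hR i hx
  have hgi : Integrable (fun ω => inner ℝ (G.gradψ i x (G.ξ ω)) (z - b)) P :=
    hg.inner_const _
  obtain ⟨hm1, hm2⟩ := hR.moment i x hx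
  have hpt : ∀ ω, ‖G.sgStep mu γ i y z (G.ξ ω) - b‖ ^ 2 ≤
      (‖z - b‖ ^ 2 - 2 * γ * mu * inner ℝ (z - y i) (z - b) + 2 * γ ^ 2 * mu ^ 2 * D ^ 2)
        - 2 * γ * inner ℝ (G.gradψ i x (G.ξ ω)) (z - b)
        + 2 * γ ^ 2 * ‖G.gradψ i x (G.ξ ω)‖ ^ 2 := by
    intro ω
    set g := G.gradψ i x (G.ξ ω)
    -- As `b` is feasible it is its own projection, and its variational inequality is `0 ≤ 0`.
    have h1 := norm_proj_sub_le (hR.isCompact i) (hR.convex i) ⟨z, hz⟩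
      (z - γ • (g + mu • (z - y i))) b hb.1 (fun w _ => by simp)
    have h2 := pow_le_pow_left₀ (norm_nonneg _) h1 2
    have e : z - γ • (g + mu • (z - y i)) - b = (z - b) - γ • (g + mu • (z - y i)) := by abel
    rw [e, norm_sub_sq_real (z - b), norm_smul, mul_pow, real_inner_smul_right, inner_add_right,
      real_inner_smul_right, real_inner_comm g, real_inner_comm (z - y i)] at h2
    have h3 : ‖g + mu • (z - y i)‖ ^ 2 ≤ 2 * ‖g‖ ^ 2 + 2 * (mu ^ 2 * D ^ 2) := by
      have h4 := norm_add_le g (mu • (z - y i))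
      have h5 := norm_sub_sq_le_diam hR i hz (hy i)
      have h6 : ‖mu • (z - y i)‖ ^ 2 ≤ mu ^ 2 * D ^ 2 := by
        rw [norm_smul, mul_pow, Real.norm_eq_abs, sq_abs]
        exact mul_le_mul_of_nonneg_left h5 (by positivity)
      have h7 := pow_le_pow_left₀ (norm_nonneg _) h4 2
      nlinarith [sq_nonneg (‖g‖ - ‖mu • (z - y i)‖)]
    have h4 := mul_le_mul_of_nonneg_left h3 (sq_nonneg γ)
    rw [Real.norm_eq_abs, sq_abs] at h2
    calc _ ≤ _ := h2
      _ ≤ _ := by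
        rw [real_inner_comm (z - b) g, real_inner_comm (z - b) (z - y i)] at *
        nlinarith
  have hF : Integrable (fun ω => (‖z - b‖ ^ 2 - 2 * γ * mu * inner ℝ (z - y i) (z - b)
      + 2 * γ ^ 2 * mu ^ 2 * D ^ 2) - 2 * γ * inner ℝ (G.gradψ i x (G.ξ ω)) (z - b)) P :=
    (integrable_const _).sub (hgi.const_mul _)
  have hbd := integral_mono_of_nonneg (Filter.Eventually.of_forall fun ω => by positivity)
    (hF.add (hm1.const_mul (2 * γ ^ 2))) (Filter.Eventually.of_forall hpt)
  refine hbd.trans ?_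
  simp only [Pi.add_apply]
  rw [integral_add hF (hm1.const_mul _), integral_sub (integrable_const _) (hgi.const_mul _),
    integral_const_mul, integral_const_mul, integral_const]
  have e1 : ∫ ω, inner ℝ (G.gradψ i x (G.ξ ω)) (z - b) ∂P = inner ℝ (G.gradf P i x) (z - b) := by
    rw [hR.unbiased i x hx, real_inner_comm, ← integral_inner hg]
    simp only [real_inner_comm]
  rw [e1]
  have h1 := mul_norm_sq_le_inner_of_proxVI hR i hy hb hz
  rw [inner_add_left, real_inner_smul_left, ← hxdef] at h1
  have h2 := mul_le_mul_of_nonneg_left h1 (by positivity : 0 ≤ 2 * γ)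
  have h3 := mul_le_mul_of_nonneg_left hm2 (by positivity : 0 ≤ 2 * γ ^ 2)
  have e2 : (1 - 2 / r) * ‖z - b‖ ^ 2 + G.Q mu M i / r ^ 2
      = ‖z - b‖ ^ 2 - 2 * γ * (mu * ‖z - b‖ ^ 2) + 2 * γ ^ 2 * M i ^ 2
        + 2 * γ ^ 2 * mu ^ 2 * D ^ 2 := by
    rw [Q, hγ]; field_simp; ring
  rw [e2]
  simp only [probReal_univ, smul_eq_mul, one_mul]
  nlinarith

/-- Mean square error of the projected stochastic gradient method for a strongly monotone
proximal problem. -/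
theorem integral_sa_sub_sq_le (hR : G.Regular P M) (hmu : 0 < mu) (i : Fin N) {y : Profile G.n}
    (hy : y ∈ G.feasible) {b : Strat G.n i} (hb : G.ProxVI P mu i y b)
    {s : ℕ → Ω → EuclideanSpace ℝ (Fin d)} (hs : ∀ t, Measurable (s t))
    (hind : iIndepFun s P) (hlaw : ∀ t, IdentDistrib (s t) G.ξ P P) (t : ℕ) :
    ∫ ω, ‖G.sa mu i y (fun u => s u ω) t - b‖ ^ 2 ∂P ≤ G.Q mu M i / (t + 2) := by
  induction t with
  | zero =>
    simp only [sa, integral_const, probReal_univ, smul_eq_mul, one_mul]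
    -- At time `0` the bound is `Q / 2`, which the summand `2 D²` of `Q` covers.
    have h := norm_sub_sq_le_diam hR i (hy i) hb.1
    have h2 : 0 ≤ 2 * M i ^ 2 / mu ^ 2 := by positivity
    rw [Q]; push_cast; linarith
  | succ t ih =>
    set Z : Ω → G.X i := fun ω => ⟨G.sa mu i y (fun u => s u ω) t, sa_mem hR i hy _ t⟩
    have hsall : Measurable fun ω => fun u => s u ω := measurable_pi_iff.2 hs
    have hZ : Measurable Z :=
      ((measurable_sa hR i t).comp
        ((measurable_const (a := (⟨y, hy⟩ : G.feasible))).prodMk hsall)).subtype_mk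
    have hZs : IndepFun Z (s t) P := by
      have h1 := hind.indepFun_finset (Finset.range t) {t} (by simp) hs
      -- Padding by `0` exhibits the current point as a function of the first `t` samples only.
      set ext : (Finset.range t → EuclideanSpace ℝ (Fin d)) → ℕ → EuclideanSpace ℝ (Fin d) :=
        fun r u => if hu : u ∈ Finset.range t then r ⟨u, hu⟩ else 0
      have hext : Measurable ext := by
        refine measurable_pi_iff.2 fun u => ?_
        by_cases hu : u ∈ Finset.range t
        · simp only [ext, dif_pos hu]
          exact measurable_pi_apply (X := fun _ : Finset.range t => EuclideanSpace ℝ (Fin d))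
            ⟨u, hu⟩
        · simp only [ext, dif_neg hu]
          exact measurable_const
      have h2 : Measurable fun r => (⟨G.sa mu i y (ext r) t, sa_mem hR i hy _ t⟩ : G.X i) :=
        ((measurable_sa hR i t).comp
          ((measurable_const (a := (⟨y, hy⟩ : G.feasible))).prodMk hext)).subtype_mk
      have h3 := h1.comp h2
        (measurable_pi_apply (⟨t, by simp⟩ : ({t} : Finset ℕ)))
      have e : Z = (fun r => (⟨G.sa mu i y (ext r) t, sa_mem hR i hy _ t⟩ : G.X i)) ∘
          fun ω (u : Finset.range t) => s u ω := by
        ext1 ω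
        refine Subtype.ext ?_
        exact sa_congr i y t fun u hu => by simp [ext, hu]
      rw [e]; exact h3
    have hr : (0 : ℝ) < t + 2 := by positivity
    set γ := 1 / (mu * ((t : ℝ) + 2))
    have hstep : Measurable fun q : G.X i × EuclideanSpace ℝ (Fin d) =>
        G.sgStep mu γ i y q.1 q.2 := by
      have h2 : Measurable fun q : G.X i × EuclideanSpace ℝ (Fin d) =>
          (((⟨y, hy⟩ : G.feasible), q.1), q.2) :=
        (measurable_const.prodMk measurable_fst).prodMk measurable_snd
      have h3 := measurable_sgStep (mu := mu) hR i ⟨y i, hy i⟩ γ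
      have h4 := h3.comp h2
      exact h4
    have hmemStep : ∀ q : G.X i × EuclideanSpace ℝ (Fin d), G.sgStep mu γ i y q.1 q.2 ∈ G.X i :=
      fun q => proj_mem (hR.isCompact i) ⟨_, hy i⟩ _
    have hΦ : Measurable fun q : G.X i × EuclideanSpace ℝ (Fin d) =>
        ‖G.sgStep mu γ i y q.1 q.2 - b‖ ^ 2 := (hstep.sub_const b).norm.pow_const 2
    have hh : Measurable fun z : G.X i =>
        (1 - 2 / ((t : ℝ) + 2)) * ‖(z : Strat G.n i) - b‖ ^ 2 + G.Q mu M i / ((t : ℝ) + 2) ^ 2 :=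
      (((measurable_subtype_coe.sub_const b).norm.pow_const 2).const_mul _).add_const _
    have hi : Integrable (fun ω => ‖G.sa mu i y (fun u => s u ω) t - b‖ ^ 2) P :=
      Integrable.of_bound
        (((measurable_subtype_coe.comp hZ).sub_const b).norm.pow_const 2).aestronglyMeasurable
        (Metric.diam (G.X i) ^ 2) (Filter.Eventually.of_forall fun ω => by
          rw [Real.norm_of_nonneg (by positivity)]
          exact norm_sub_sq_le_diam hR i (sa_mem hR i hy _ t) hb.1)
    have hcond : ∀ z : G.X i, ∫ ω, ‖G.sgStep mu γ i y z (s t ω) - b‖ ^ 2 ∂P ≤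
        (1 - 2 / ((t : ℝ) + 2)) * ‖(z : Strat G.n i) - b‖ ^ 2
          + G.Q mu M i / ((t : ℝ) + 2) ^ 2 := fun z => by
      have h1 := integral_sgStep_le hR hmu i hy hb z.2 (t + 2) hr
      have h2 := hΦ.comp (measurable_prodMk_left (x := z))
      have h3 := ((hlaw t).comp h2).integral_eq
      simp only [Function.comp_def] at h3
      rw [h3]
      exact h1
    have key := integral_le_of_indepFun hZ (hs t) hZs hΦ (B := Metric.diam (G.X i) ^ 2)
      (fun q => by
        rw [Real.norm_of_nonneg (by positivity)]
        exact norm_sub_sq_le_diam hR i (hmemStep q) hb.1)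
      hh ((hi.const_mul _).add (integrable_const _)) hcond
    have e1 : ∫ ω, ((1 - 2 / ((t : ℝ) + 2)) * ‖(Z ω : Strat G.n i) - b‖ ^ 2
        + G.Q mu M i / ((t : ℝ) + 2) ^ 2) ∂P
        = (1 - 2 / ((t : ℝ) + 2)) * ∫ ω, ‖G.sa mu i y (fun u => s u ω) t - b‖ ^ 2 ∂P
          + G.Q mu M i / ((t : ℝ) + 2) ^ 2 := by
      rw [integral_add (hi.const_mul _) (integrable_const _), integral_const_mul]
      simp
    simp_rw [sa_succ]
    refine key.trans ?_
    rw [e1]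
    have hQ := Q_pos hR hmu i (P := P)
    have h0 : 0 ≤ 1 - 2 / ((t : ℝ) + 2) := by
      rw [sub_nonneg, div_le_one hr]; linarith [(Nat.cast_nonneg t : (0 : ℝ) ≤ t)]
    have h1 := mul_le_mul_of_nonneg_left ih h0
    refine (add_le_add_left h1 _).trans ?_
    -- The induction closes because `(t + 1)(t + 3) ≤ (t + 2)²`.
    have e2 : (1 - 2 / ((t : ℝ) + 2)) * (G.Q mu M i / (t + 2)) + G.Q mu M i / ((t : ℝ) + 2) ^ 2
        = G.Q mu M i * ((t + 1) / (t + 2) ^ 2) := by field_simp; ring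
    rw [e2, div_eq_mul_inv (G.Q mu M i)]
    refine mul_le_mul_of_nonneg_left ?_ hQ.le
    push_cast
    rw [div_le_iff₀ (by positivity), inv_mul_eq_div, le_div_iff₀ (by positivity)]
    nlinarith

end Game

/-! ### The inner solves inside the randomized scheme -/

/-- A conditional expectation is bounded by a measurable function if all its set integrals are. -/
theorem condExp_le_of_setIntegral_le {Ω : Type*} {m m0 : MeasurableSpace Ω} {P : Measure Ω}
    [IsFiniteMeasure P] (hm : m ≤ m0) {f g : Ω → ℝ} (hf : Integrable f P) (hg : Integrable g P)
    (hgm : StronglyMeasurable[m] g)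
    (h : ∀ A, MeasurableSet[m] A → ∫ ω in A, f ω ∂P ≤ ∫ ω in A, g ω ∂P) :
    P[f | m] ≤ᵐ[P] g := by
  refine ae_le_of_ae_le_trim (hm := hm) ?_
  refine ae_le_of_forall_setIntegral_le
    (integrable_condExp.trim hm stronglyMeasurable_condExp) (hg.trim hm hgm) fun A hA _ => ?_
  rw [← setIntegral_trim hm stronglyMeasurable_condExp hA, ← setIntegral_trim hm hgm hA,
    setIntegral_condExp hm hf hA]
  exact h A hA

namespace Driver

section

variable {N d : ℕ} {Ω : Type*} {G : Game N d Ω} {S : Driver G} {mu : ℝ} {J : Fin N → ℕ → ℕ}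

/-- The step count is random but takes values in the countable `ℕ`, so measurability is checked
slice by slice. -/
theorem measurable_sa_random {Ω' : Type*} {m : MeasurableSpace Ω'} {i : Fin N}
    (hsa : ∀ t, Measurable fun q : G.feasible × (ℕ → EuclideanSpace ℝ (Fin d)) =>
      G.sa mu i q.1 q.2 t)
    {Y : Ω' → G.feasible} {b : Ω' → ℕ} {s : Ω' → ℕ → EuclideanSpace ℝ (Fin d)}
    (hY : Measurable Y) (hb : Measurable b) (hs : Measurable s) :
    Measurable fun ω => G.sa mu i (Y ω) (s ω) (J i (b ω)) := by
  have h : Measurable fun q : (G.feasible × (ℕ → EuclideanSpace ℝ (Fin d))) × ℕ =>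
      G.sa mu i q.1.1 q.1.2 (J i q.2) :=
    measurable_from_prod_countable_left fun n => hsa (J i n)
  exact h.comp ((hY.prodMk hs).prodMk hb)

theorem β_succ (i : Fin N) (k : ℕ) (ω : Ω) :
    S.β i (k + 1) ω = if S.χ i k ω = true then S.β i k ω + 1 else S.β i k ω := by
  simp only [β, Finset.range_add_one, Finset.filter_insert]
  split_ifs <;> simp

theorem β_le (i : Fin N) (k : ℕ) (ω : Ω) : S.β i k ω ≤ k :=
  (Finset.card_filter_le _ _).trans (by simp)

theorem info_succ (k : ℕ) : S.info J k ≤ S.info J (k + 1) := by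
  refine sup_le_sup le_rfl (iSup_le fun l => ?_)
  exact le_iSup (fun l : Fin (k + 1) => ⨆ i : Fin N,
    (MeasurableSpace.comap (S.χ i l) inferInstance ⊔
      ⨆ t : ℕ, MeasurableSpace.comap (S.used J i l t) inferInstance)) l.castSucc

theorem measurable_χ_info (i : Fin N) (k : ℕ) : Measurable[S.info J (k + 1)] (S.χ i k) := by
  refine Measurable.of_comap_le (le_trans ?_ le_sup_right)
  refine le_trans ?_ (le_iSup _ (Fin.last k))
  refine le_trans ?_ (le_iSup _ i)
  exact le_sup_left

theorem measurable_used_info (i : Fin N) (k t : ℕ) :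
    Measurable[S.info J (k + 1)] (S.used J i k t) := by
  refine Measurable.of_comap_le (le_trans ?_ le_sup_right)
  refine le_trans ?_ (le_iSup _ (Fin.last k))
  refine le_trans ?_ (le_iSup _ i)
  refine le_trans ?_ le_sup_right
  exact le_iSup (fun t => MeasurableSpace.comap (S.used J i k t) inferInstance) t

theorem measurableSet_active {m : MeasurableSpace Ω} {c : Ω → Bool} (hc : Measurable[m] c) :
    MeasurableSet[m] {ω | c ω = true} :=
  hc (measurableSet_singleton true)

theorem measurable_β_of_χ {m : MeasurableSpace Ω} (i : Fin N) (k : ℕ)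
    (h : ∀ l < k, Measurable[m] (S.χ i l)) : Measurable[m] (S.β i k) := by
  induction k with
  | zero =>
    have e : S.β i 0 = fun _ => 0 := by ext; simp [β]
    rw [e]; exact measurable_const
  | succ k ih =>
    have h1 := ih fun l hl => h l (hl.trans k.lt_succ_self)
    have e : S.β i (k + 1)
        = fun ω => if S.χ i k ω = true then S.β i k ω + 1 else S.β i k ω :=
      funext fun ω => β_succ i k ω
    rw [e]
    exact Measurable.ite (measurableSet_active (h k k.lt_succ_self)) (h1.add_const 1) h1

theorem info_mono : Monotone (S.info J) := monotone_nat_of_le_succ info_succ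

theorem measurable_β_info (i : Fin N) (k : ℕ) : Measurable[S.info J k] (S.β i k) :=
  measurable_β_of_χ i k fun l hl =>
    (measurable_χ_info i l).mono (info_mono (Nat.succ_le_of_lt hl)) le_rfl

theorem iter_succ (k : ℕ) (ω : Ω) (i : Fin N) :
    S.iter mu J (k + 1) ω i = if S.χ i k ω = true then
      G.sa mu i (S.iter mu J k ω) (fun t => S.sample i k t ω) (J i (S.β i k ω))
    else S.iter mu J k ω i := rfl

/-- The σ-field `info` records only samples that were used, so adaptedness of the iterates needs
this form of the recursion. -/
theorem iter_succ_used (k : ℕ) (ω : Ω) (i : Fin N) :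
    S.iter mu J (k + 1) ω i = if S.χ i k ω = true then
      G.sa mu i (S.iter mu J k ω) (fun t => S.used J i k t ω) (J i (S.β i k ω))
    else S.iter mu J k ω i := by
  rw [iter_succ]
  split_ifs with h
  · exact Game.sa_congr i _ _ fun u hu => by simp [used, h, hu]
  · rfl

theorem comap_samples (i : Fin N) (k : ℕ) :
    MeasurableSpace.comap (fun ω t => S.sample i k t ω) inferInstance
      = ⨆ t : ℕ, MeasurableSpace.comap (S.sample i k t) inferInstance := by
  simp only [MeasurableSpace.pi, MeasurableSpace.comap_iSup, MeasurableSpace.comap_comp]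
  rfl

end

theorem div_stepRule_le {Q : Fin N → ℝ} {η : ℝ} (hη : 0 < η) {i : Fin N} (m : ℕ) :
    Q i / ((stepRule Q η i m : ℝ) + 2) ≤ (η ^ (m + 1)) ^ 2 := by
  have h1 : Q i / η ^ (2 * (m + 1)) ≤ (stepRule Q η i m : ℝ) := Nat.le_ceil _
  rw [div_le_iff₀ (by positivity)] at h1
  rw [div_le_iff₀ (by positivity), ← pow_mul, mul_comm (m + 1)]
  have h2 : 0 < η ^ (2 * (m + 1)) := by positivity
  nlinarith

variable {N d : ℕ} {Ω : Type*} [MeasurableSpace Ω] {G : Game N d Ω} {S : Driver G}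
  {P : Measure Ω} {M : Fin N → ℝ} {mu : ℝ} {J : Fin N → ℕ → ℕ} {p : Fin N → ℝ}

theorem measurable_β (hS : S.Admissible P J p) (i : Fin N) (k : ℕ) : Measurable (S.β i k) :=
  measurable_β_of_χ i k fun l _ => hS.measurable_χ i l

theorem measurable_used (hS : S.Admissible P J p) (i : Fin N) (k t : ℕ) :
    Measurable (S.used J i k t) := by
  refine Measurable.ite ?_ (hS.measurable_sample i k t) measurable_const
  refine (measurableSet_active (hS.measurable_χ i k)).inter ?_
  exact measurable_β hS i k (MeasurableSet.of_discrete (s := {n | t < J i n}))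

theorem info_le (hS : S.Admissible P J p) (k : ℕ) : S.info J k ≤ ‹MeasurableSpace Ω› := by
  refine sup_le hS.measurable_x0.comap_le (iSup_le fun l => iSup_le fun i => sup_le ?_
    (iSup_le fun t => ?_))
  · exact (hS.measurable_χ i l).comap_le
  · exact (measurable_used hS i l t).comap_le

theorem iter_mem (hR : G.Regular P M) (hS : S.Admissible P J p) (k : ℕ) (ω : Ω) :
    S.iter mu J k ω ∈ G.feasible := by
  induction k with
  | zero => exact hS.x0_mem ω
  | succ k ih =>
    intro i
    rw [iter_succ]
    split_ifs
    · exact Game.sa_mem hR i ih _ _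
    · exact ih i

/-- The iterates as elements of the feasible set. -/
noncomputable def iterF (hR : G.Regular P M) (hS : S.Admissible P J p) (mu : ℝ) (k : ℕ) (ω : Ω) : G.feasible :=
  ⟨S.iter mu J k ω, iter_mem hR hS k ω⟩

theorem measurable_iter_info (hR : G.Regular P M) (hS : S.Admissible P J p) (k : ℕ) :
    Measurable[S.info J k] (S.iter mu J k) := by
  induction k with
  | zero => exact Measurable.of_comap_le le_sup_left
  | succ k ih =>
    have h1 : Measurable[S.info J (k + 1)] (S.iter mu J k) := ih.mono (info_succ k) le_rfl
    have h2 : Measurable[S.info J (k + 1)] (iterF hR hS mu k) := h1.subtype_mk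
    refine (@measurable_pi_iff _ _ _ (S.info J (k + 1)) _ _).2 fun i => ?_
    simp_rw [iter_succ_used]
    have h3 : Measurable[S.info J (k + 1)] fun ω t => S.used J i k t ω :=
      (@measurable_pi_iff _ _ _ (S.info J (k + 1)) _ _).2 fun t => measurable_used_info i k t
    refine Measurable.ite (measurableSet_active (measurable_χ_info i k)) ?_
      ((measurable_pi_apply i).comp h1)
    exact measurable_sa_random (Game.measurable_sa hR i) h2
      ((measurable_β_info i k).mono (info_succ k) le_rfl) h3

theorem measurable_iterF_info (hR : G.Regular P M) (hS : S.Admissible P J p) (k : ℕ) :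
    Measurable[S.info J k] (iterF hR hS mu k) :=
  (measurable_iter_info hR hS k).subtype_mk

theorem measurable_iter (hR : G.Regular P M) (hS : S.Admissible P J p) (k : ℕ) :
    Measurable (S.iter mu J k) :=
  (measurable_iter_info hR hS k).mono (info_le hS k) le_rfl

/-- The point player `i` reaches at major iteration `k` if active. -/
noncomputable def inner (S : Driver G) (mu : ℝ) (J : Fin N → ℕ → ℕ) (i : Fin N) (k : ℕ) (ω : Ω) :
    Strat G.n i :=
  G.sa mu i (S.iter mu J k ω) (fun t => S.sample i k t ω) (J i (S.β i k ω))

theorem measurable_samples (hS : S.Admissible P J p) (i : Fin N) (k : ℕ) :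
    Measurable fun ω t => S.sample i k t ω :=
  measurable_pi_iff.2 fun t => hS.measurable_sample i k t

theorem measurable_inner (hR : G.Regular P M) (hS : S.Admissible P J p) (i : Fin N) (k : ℕ) :
    Measurable (S.inner mu J i k) :=
  measurable_sa_random (Game.measurable_sa hR i)
    ((measurable_iterF_info hR hS k).mono (info_le hS k) le_rfl) (measurable_β hS i k)
    (measurable_samples hS i k)

theorem inner_mem (hR : G.Regular P M) (hS : S.Admissible P J p) (i : Fin N) (k : ℕ) (ω : Ω) :
    S.inner mu J i k ω ∈ G.X i :=
  Game.sa_mem hR i (iter_mem hR hS k ω) _ _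

theorem measurable_proxBR_iter (hR : G.Regular P M) (hmu : 0 < mu) (hS : S.Admissible P J p)
    (i : Fin N) (k : ℕ) :
    Measurable[S.info J k] fun ω => G.proxBR P mu i (S.iter mu J k ω) := by
  have h1 := (Game.continuous_proxBR hR hmu i).measurable
  have h2 := h1.comp (measurable_iterF_info (mu := mu) hR hS k)
  exact h2

theorem integrable_norm_sub_sq [IsFiniteMeasure P] (hR : G.Regular P M) {i : Fin N}
    {z w : Ω → Strat G.n i} (hz : Measurable z) (hw : Measurable w) (hzX : ∀ ω, z ω ∈ G.X i)
    (hwX : ∀ ω, w ω ∈ G.X i) : Integrable (fun ω => ‖z ω - w ω‖ ^ 2) P :=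
  Integrable.of_bound ((hz.sub hw).norm.pow_const 2).aestronglyMeasurable
    (Metric.diam (G.X i) ^ 2) (Filter.Eventually.of_forall fun ω => by
      rw [Real.norm_of_nonneg (by positivity)]
      exact Game.norm_sub_sq_le_diam hR i (hzX ω) (hwX ω))

/-- Since `β ≤ k`, every function of it takes finitely many values. -/
theorem integrable_comp_β [IsFiniteMeasure P] (hS : S.Admissible P J p) (i : Fin N) (k : ℕ)
    (h : ℕ → ℝ) : Integrable (fun ω => h (S.β i k ω)) P := by
  refine Integrable.of_bound
    ((Measurable.of_discrete (f := h)).comp (measurable_β hS i k)).aestronglyMeasurable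
    (∑ l ∈ Finset.range (k + 1), ‖h l‖) (Filter.Eventually.of_forall fun ω => ?_)
  exact Finset.single_le_sum (f := fun l => ‖h l‖) (fun _ _ => norm_nonneg _)
    (Finset.mem_range.2 (Nat.lt_succ_of_le (β_le i k ω)))

variable [IsProbabilityMeasure P]

/-- The inexactness criterion, integrated over an event decided before the samples are drawn. -/
theorem setIntegral_inner_sub_sq_le (hR : G.Regular P M) (hmu : 0 < mu) {η : ℝ} (hη : 0 < η)
    (hJ : J = stepRule (G.Q mu M) η) (hS : S.Admissible P J p) (i : Fin N) (k : ℕ) {A : Set Ω}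
    (hA : MeasurableSet[S.info J k ⊔ MeasurableSpace.comap (S.χ i k) inferInstance] A) :
    ∫ ω in A, ‖S.inner mu J i k ω - G.proxBR P mu i (S.iter mu J k ω)‖ ^ 2 ∂P ≤
      ∫ ω in A, (η ^ (S.β i k ω + 1)) ^ 2 ∂P := by
  have hm := sup_le (info_le hS k) (hS.measurable_χ i k).comap_le
  have hY : Measurable[S.info J k ⊔ MeasurableSpace.comap (S.χ i k) inferInstance] fun ω => (iterF hR hS mu k ω, S.β i k ω) :=
    ((measurable_iterF_info hR hS k).mono le_sup_left le_rfl).prodMk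
      ((measurable_β_info i k).mono le_sup_left le_rfl)
  have hind := hS.sample_indep i k
  rw [← comap_samples] at hind
  have hΦ : Measurable fun q : (G.feasible × ℕ) × (ℕ → EuclideanSpace ℝ (Fin d)) =>
      ‖G.sa mu i q.1.1 q.2 (J i q.1.2) - G.proxBR P mu i q.1.1‖ ^ 2 := by
    have h1 := measurable_sa_random (J := J) (Game.measurable_sa (mu := mu) hR i)
      (Y := fun q : (G.feasible × ℕ) × (ℕ → EuclideanSpace ℝ (Fin d)) => q.1.1)
      (b := fun q => q.1.2) (s := fun q => q.2) (by fun_prop) (by fun_prop) (by fun_prop)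
    have h2 := (Game.continuous_proxBR hR hmu i).measurable.comp
      (measurable_fst.comp measurable_fst :
        Measurable fun q : (G.feasible × ℕ) × (ℕ → EuclideanSpace ℝ (Fin d)) => q.1.1)
    exact (h1.sub h2).norm.pow_const 2
  -- With iterate and counter frozen, both the proximal problem and the step count are
  -- deterministic, leaving a plain SG run on i.i.d. samples.
  have hcond : ∀ y : G.feasible × ℕ,
      ∫ ω, ‖G.sa mu i y.1 (fun t => S.sample i k t ω) (J i y.2) - G.proxBR P mu i y.1‖ ^ 2 ∂P ≤
        (η ^ (y.2 + 1)) ^ 2 := fun y => by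
    refine (Game.integral_sa_sub_sq_le hR hmu i y.1.2 (Game.proxVI_proxBR hR i y.1.2)
      (hS.measurable_sample i k) (hS.sample_iid i k) (hS.sample_law i k) (J i y.2)).trans ?_
    rw [hJ]
    exact div_stepRule_le hη y.2
  exact setIntegral_le_of_indep hm hY (measurable_samples hS i k) hind hΦ
    (B := Metric.diam (G.X i) ^ 2)
    (fun q => by
      rw [Real.norm_of_nonneg (by positivity)]
      exact Game.norm_sub_sq_le_diam hR i (Game.sa_mem hR i q.1.1.2 _ _)
        (Game.proxBR_spec hR i q.1.1.2).1)
    (h := fun y => (η ^ (y.2 + 1)) ^ 2)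
    ((Measurable.of_discrete (f := fun n : ℕ => (η ^ (n + 1)) ^ 2)).comp measurable_snd)
    (integrable_comp_β hS i k fun n => (η ^ (n + 1)) ^ 2) hcond hA

theorem integrable_inner_sub_sq (hR : G.Regular P M) (hmu : 0 < mu)
    (hS : S.Admissible P J p) (i : Fin N) (k : ℕ) :
    Integrable
      (fun ω => ‖S.inner mu J i k ω - G.proxBR P mu i (S.iter mu J k ω)‖ ^ 2) P :=
  integrable_norm_sub_sq hR (measurable_inner hR hS i k)
    ((measurable_proxBR_iter hR hmu hS i k).mono (info_le hS k) le_rfl) (inner_mem hR hS i k)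
    fun ω => (Game.proxBR_spec hR i (iter_mem hR hS k ω)).1

theorem condExp_inner_sub_sq_le (hR : G.Regular P M) (hmu : 0 < mu) {η : ℝ} (hη : 0 < η)
    (hJ : J = stepRule (G.Q mu M) η) (hS : S.Admissible P J p) (i : Fin N) (k : ℕ) :
    P[fun ω => ‖S.inner mu J i k ω - G.proxBR P mu i (S.iter mu J k ω)‖ ^ 2 | S.info J k]
      ≤ᵐ[P] fun ω => (η ^ (S.β i k ω + 1)) ^ 2 := by
  refine condExp_le_of_setIntegral_le (info_le hS k) (integrable_inner_sub_sq hR hmu hS i k)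
    (integrable_comp_β hS i k fun n => (η ^ (n + 1)) ^ 2) ?_ fun A hA =>
      setIntegral_inner_sub_sq_le hR hmu hη hJ hS i k
        ((le_sup_left : S.info J k ≤ S.info J k ⊔ _) A hA)
  exact ((Measurable.of_discrete (f := fun n : ℕ => (η ^ (n + 1)) ^ 2)).comp
    (measurable_β_info i k)).stronglyMeasurable

end Driver

/-! ### Parameters of the scheme -/

section Parameters

variable {N : ℕ} {p : Fin N → ℝ}

theorem iInf_p_le (p : Fin N → ℝ) (i : Fin N) : ⨅ j, p j ≤ p i :=
  ciInf_le (Set.finite_range p).bddBelow i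

theorem le_iSup_p (p : Fin N → ℝ) (i : Fin N) : p i ≤ ⨆ j, p j :=
  le_ciSup (Set.finite_range p).bddAbove i

theorem iInf_p_pos [Nonempty (Fin N)] (hp : ∀ i, 0 < p i) : 0 < ⨅ j, p j := by
  obtain ⟨i, hi⟩ := exists_eq_ciInf_of_finite (f := p)
  rw [← hi]; exact hp i

theorem iInf_p_le_one (hp1 : ∀ i, p i ≤ 1) : ⨅ j, p j ≤ 1 := by
  rcases isEmpty_or_nonempty (Fin N) with h | ⟨⟨i⟩⟩
  · rw [Real.iInf_of_isEmpty]; exact zero_le_one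
  · exact (iInf_p_le p i).trans (hp1 i)

theorem sq_le_one_sub_mul {P a : ℝ} (hP1 : P ≤ 1) (ha0 : 0 ≤ a) (ha1 : a ≤ 1) :
    a ^ 2 ≤ 1 - P * (1 - a ^ 2) := by
  have : a ^ 2 ≤ 1 := by nlinarith
  nlinarith

theorem aTil_sq (hp1 : ∀ i, p i ≤ 1) {a : ℝ} (ha0 : 0 ≤ a) (ha1 : a ≤ 1) :
    aTil p a ^ 2 = 1 - (⨅ i, p i) * (1 - a ^ 2) :=
  Real.sq_sqrt ((sq_nonneg a).trans (sq_le_one_sub_mul (iInf_p_le_one hp1) ha0 ha1))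

theorem etaTil_sq (hp1 : ∀ i, p i ≤ 1) {η : ℝ} (h0 : 0 ≤ η) (h1 : η ≤ 1) :
    etaTil p η ^ 2 = 1 - (⨅ i, p i) * (1 - η ^ 2) := aTil_sq hp1 h0 h1

theorem etaTil_pos (hp1 : ∀ i, p i ≤ 1) {η : ℝ} (h0 : 0 < η) (h1 : η ≤ 1) : 0 < etaTil p η :=
  Real.sqrt_pos.2 ((by positivity : 0 < η ^ 2).trans_le
    (sq_le_one_sub_mul (iInf_p_le_one hp1) h0.le h1))

end Parameters

/-! ### Young's inequality with a free parameter -/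

theorem norm_sub_sq_le_young {E : Type*} [NormedAddCommGroup E] (z b x : E) {τ : ℝ} (hτ : 0 < τ) :
    ‖z - x‖ ^ 2 ≤ (1 + τ) * ‖b - x‖ ^ 2 + (1 + τ⁻¹) * ‖z - b‖ ^ 2 := by
  have h1 : ‖z - x‖ ≤ ‖b - x‖ + ‖z - b‖ := by
    rw [add_comm]; exact norm_sub_le_norm_sub_add_norm_sub z b x
  have h2 := pow_le_pow_left₀ (norm_nonneg _) h1 2
  have h3 : (1 + τ) * ‖b - x‖ ^ 2 + (1 + τ⁻¹) * ‖z - b‖ ^ 2 - (‖b - x‖ + ‖z - b‖) ^ 2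
      = τ⁻¹ * (τ * ‖b - x‖ - ‖z - b‖) ^ 2 := by field_simp; ring
  have h4 : 0 ≤ τ⁻¹ * (τ * ‖b - x‖ - ‖z - b‖) ^ 2 := by positivity
  linarith

/-- The optimal parameter is `τ = B / A`. For `A = 0` the infimum is only approached, as `τ → ∞`. -/
theorem le_add_sq_of_forall_young {x A B : ℝ} (hA : 0 ≤ A) (hB : 0 < B)
    (h : ∀ τ : ℝ, 0 < τ → x ≤ (1 + τ) * A ^ 2 + (1 + τ⁻¹) * B ^ 2) : x ≤ (A + B) ^ 2 := by
  rcases hA.eq_or_lt with rfl | hA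
  · refine le_of_forall_pos_le_add fun ε hε => ?_
    have h1 := h (B ^ 2 / ε) (by positivity)
    have e : (1 + (B ^ 2 / ε)) * 0 ^ 2 + (1 + (B ^ 2 / ε)⁻¹) * B ^ 2 = (0 + B) ^ 2 + ε := by
      field_simp; ring
    linarith
  · have h1 := h (B / A) (by positivity)
    have e : (1 + B / A) * A ^ 2 + (1 + (B / A)⁻¹) * B ^ 2 = (A + B) ^ 2 := by
      field_simp; ring
    linarith

/-! ### Averaging over the activation indicators -/

namespace Driver

theorem measurable_comp_β_info {N d : ℕ} {Ω : Type*} {G : Game N d Ω} {S : Driver G}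
    {J : Fin N → ℕ → ℕ} (i : Fin N) (k : ℕ) (h : ℕ → ℝ) :
    Measurable[S.info J k] fun ω => h (S.β i k ω) :=
  (Measurable.of_discrete (f := h)).comp (measurable_β_info i k)

variable {N d : ℕ} {Ω : Type*} [MeasurableSpace Ω] {G : Game N d Ω} {S : Driver G}
  {P : Measure Ω} {M : Fin N → ℝ} {mu : ℝ} {J : Fin N → ℕ → ℕ} {p : Fin N → ℝ}

theorem setIntegral_active (hS : S.Admissible P J p) (i : Fin N) (k : ℕ) {U : Ω → ℝ}
    (hU : Measurable[S.info J k] U) :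
    ∫ ω in {ω | S.χ i k ω = true}, U ω ∂P = p i * ∫ ω, U ω ∂P := by
  have hU0 : Measurable U := hU.mono (info_le hS k) le_rfl
  rw [← hS.χ_law i k]
  exact Indep.setIntegral_eq_mul (hS.measurable_χ i k).comap_le (f := id)
    (indep_of_indep_of_le_right (hS.χ_indep i k) hU.comap_le) hU0.aemeasurable
    ⟨{true}, measurableSet_singleton _, rfl⟩ measurable_id.aestronglyMeasurable

theorem integral_ite_active (hS : S.Admissible P J p) (i : Fin N) (k : ℕ) {U W : Ω → ℝ}
    (hU : Measurable[S.info J k] U) (hW : Measurable[S.info J k] W) (hUi : Integrable U P)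
    (hWi : Integrable W P) :
    Integrable (fun ω => if S.χ i k ω = true then U ω else W ω) P ∧
    ∫ ω, (if S.χ i k ω = true then U ω else W ω) ∂P
      = p i * ∫ ω, U ω ∂P + (1 - p i) * ∫ ω, W ω ∂P := by
  have hA : MeasurableSet {ω | S.χ i k ω = true} := measurableSet_active (hS.measurable_χ i k)
  have e : (fun ω => if S.χ i k ω = true then U ω else W ω)
      = fun ω => {ω | S.χ i k ω = true}.indicator U ω
        + (W ω - {ω | S.χ i k ω = true}.indicator W ω) := by
    ext ω
    by_cases h : S.χ i k ω = true <;> simp [h]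
  have h1 := hUi.indicator hA
  have h2 : Integrable (fun ω => W ω - {ω | S.χ i k ω = true}.indicator W ω) P :=
    hWi.sub (hWi.indicator hA)
  refine ⟨e ▸ h1.add h2, ?_⟩
  rw [e, integral_add h1 h2, integral_sub hWi (hWi.indicator hA), integral_indicator hA,
    integral_indicator hA, setIntegral_active hS i k hU, setIntegral_active hS i k hW]
  ring

/-! ### The weighted mean square error -/

/-- The mean square error of player `i`. -/
noncomputable def mse (S : Driver G) (P : Measure Ω) (mu : ℝ) (J : Fin N → ℕ → ℕ)
    (xs : Profile G.n) (k : ℕ) (i : Fin N) : ℝ :=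
  ∫ ω, ‖S.iter mu J k ω i - xs i‖ ^ 2 ∂P

/-- The mean square error, weighted with the inverse activation probabilities. -/
noncomputable def wmse (S : Driver G) (P : Measure Ω) (mu : ℝ) (J : Fin N → ℕ → ℕ)
    (p : Fin N → ℝ) (xs : Profile G.n) (k : ℕ) : ℝ :=
  ∑ i, (p i)⁻¹ * S.mse P mu J xs k i

theorem mse_nonneg (xs : Profile G.n) (k : ℕ) (i : Fin N) : 0 ≤ S.mse P mu J xs k i :=
  integral_nonneg fun _ => by positivity

theorem wmse_nonneg (hS : S.Admissible P J p) (xs : Profile G.n) (k : ℕ) :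
    0 ≤ S.wmse P mu J p xs k :=
  Finset.sum_nonneg fun i _ => mul_nonneg (inv_nonneg.2 (hS.p_pos i).le) (mse_nonneg xs k i)

theorem measurable_iter_apply (hR : G.Regular P M) (hS : S.Admissible P J p) (k : ℕ)
    (i : Fin N) : Measurable fun ω => S.iter mu J k ω i :=
  (measurable_pi_apply i).comp (measurable_iter hR hS k)

theorem sqrt_wmse_zero_le (hN : 0 < N) (hS : S.Admissible P J p) {xs : Profile G.n} {C : ℝ}
    (hC : 0 ≤ C) (h0 : ∀ i, ∫ ω, ‖S.x0 ω i - xs i‖ ^ 2 ∂P ≤ C ^ 2) :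
    Real.sqrt (S.wmse P mu J p xs 0) ≤ Real.sqrt N * bigCTil p C := by
  have hN' : (0 : ℝ) < N := by exact_mod_cast hN
  have hnn : 0 ≤ ∑ i, (N : ℝ)⁻¹ * (p i)⁻¹ := Finset.sum_nonneg fun i _ =>
    mul_nonneg (inv_nonneg.2 hN'.le) (inv_nonneg.2 (hS.p_pos i).le)
  refine Real.sqrt_le_iff.2 ⟨mul_nonneg (Real.sqrt_nonneg _) (mul_nonneg hC (Real.sqrt_nonneg _)),
    ?_⟩
  rw [bigCTil, mul_pow, mul_pow, Real.sq_sqrt hN'.le, Real.sq_sqrt hnn, Finset.mul_sum,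
    Finset.mul_sum, wmse]
  refine Finset.sum_le_sum fun i _ => ?_
  have h1 := mul_le_mul_of_nonneg_left (h0 i) (inv_nonneg.2 (hS.p_pos i).le)
  refine h1.trans (le_of_eq ?_)
  field_simp

variable [IsProbabilityMeasure P]

theorem integrable_iter_sub_sq (hR : G.Regular P M) (hS : S.Admissible P J p)
    {xs : Profile G.n} (hxs : xs ∈ G.feasible) (k : ℕ) (i : Fin N) :
    Integrable (fun ω => ‖S.iter mu J k ω i - xs i‖ ^ 2) P :=
  integrable_norm_sub_sq hR (measurable_iter_apply hR hS k i) measurable_const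
    (fun ω => iter_mem hR hS k ω i) fun _ => hxs i

theorem p_le_one (hS : S.Admissible P J p) (i : Fin N) : p i ≤ 1 := by
  rw [← hS.χ_law i 0]; exact measureReal_le_one

/-- Generating function of a binomial variable, by conditioning on the last activation. It is used
at `c = η²` for the inexactness and at `c = η⁻²` for the work. -/
theorem integral_pow_β (hS : S.Admissible P J p) (i : Fin N) (c : ℝ) (k : ℕ) :
    ∫ ω, c ^ S.β i k ω ∂P = (1 - p i + p i * c) ^ k := by
  induction k with
  | zero => simp [β]
  | succ k ih =>
    have e : (fun ω => c ^ S.β i (k + 1) ω)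
        = fun ω => if S.χ i k ω = true then c * c ^ S.β i k ω else c ^ S.β i k ω := by
      ext ω
      rw [β_succ]
      split_ifs
      · rw [pow_succ']
      · rfl
    rw [e, (integral_ite_active hS i k
      (measurable_comp_β_info i k fun n => c * c ^ n)
      (measurable_comp_β_info i k fun n => c ^ n)
      (integrable_comp_β hS i k fun n => c * c ^ n)
      (integrable_comp_β hS i k fun n => c ^ n)).2, integral_const_mul, ih]
    ring

theorem integral_inexactness_le (hS : S.Admissible P J p) {η : ℝ} (h0 : 0 < η) (h1 : η < 1)
    (i : Fin N) (k : ℕ) :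
    ∫ ω, (η ^ (S.β i k ω + 1)) ^ 2 ∂P ≤ (η * etaTil p η ^ k) ^ 2 := by
  have e : (fun ω => (η ^ (S.β i k ω + 1)) ^ 2) = fun ω => η ^ 2 * (η ^ 2) ^ S.β i k ω := by
    ext ω; ring
  rw [e, integral_const_mul, integral_pow_β hS, mul_pow, ← pow_mul, mul_comm k 2, pow_mul,
    etaTil_sq (p_le_one hS) h0.le h1.le]
  refine mul_le_mul_of_nonneg_left (pow_le_pow_left₀ ?_ ?_ k) (by positivity)
  · have := p_le_one hS i
    have := mul_nonneg (hS.p_pos i).le (sq_nonneg η)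
    linarith
  · have h2 := iInf_p_le p i
    have h3 : η ^ 2 ≤ 1 := by nlinarith
    nlinarith

/-- One major iteration in mean square, with a parameter `τ` from Young's inequality. -/
theorem mse_succ_le (hR : G.Regular P M) (hmu : 0 < mu) {η : ℝ} (hη : 0 < η)
    (hJ : J = stepRule (G.Q mu M) η) (hS : S.Admissible P J p) {xs : Profile G.n}
    (hxs : xs ∈ G.feasible) (k : ℕ) (i : Fin N) {τ : ℝ} (hτ : 0 < τ) :
    S.mse P mu J xs (k + 1) i ≤
      (1 + τ) * (p i * ∫ ω, ‖G.proxBR P mu i (S.iter mu J k ω) - xs i‖ ^ 2 ∂P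
        + (1 - p i) * S.mse P mu J xs k i)
      + (1 + τ⁻¹) * (p i * ∫ ω, (η ^ (S.β i k ω + 1)) ^ 2 ∂P) := by
  have hAinfo : MeasurableSet[S.info J k ⊔ MeasurableSpace.comap (S.χ i k) inferInstance]
      {ω | S.χ i k ω = true} :=
    (le_sup_right : MeasurableSpace.comap (S.χ i k) inferInstance ≤ _) _
      ⟨{true}, measurableSet_singleton _, rfl⟩
  have hA : MeasurableSet {ω | S.χ i k ω = true} := measurableSet_active (hS.measurable_χ i k)
  have hbm := measurable_proxBR_iter hR hmu hS i k
  have hsq : Measurable fun z : Strat G.n i => ‖z - xs i‖ ^ 2 := by fun_prop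
  have hU : Measurable[S.info J k]
      fun ω => ‖G.proxBR P mu i (S.iter mu J k ω) - xs i‖ ^ 2 :=
    hsq.comp hbm
  have hUi : Integrable (fun ω => ‖G.proxBR P mu i (S.iter mu J k ω) - xs i‖ ^ 2) P :=
    integrable_norm_sub_sq hR (hbm.mono (info_le hS k) le_rfl) measurable_const
      (fun ω => (Game.proxBR_spec hR i (iter_mem hR hS k ω)).1) fun _ => hxs i
  have hW : Measurable[S.info J k] fun ω => ‖S.iter mu J k ω i - xs i‖ ^ 2 :=
    hsq.comp ((measurable_pi_apply i).comp (measurable_iter_info hR hS k))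
  obtain ⟨h1, h2⟩ := integral_ite_active hS i k hU hW hUi (integrable_iter_sub_sq hR hS hxs k i)
  have h3 := (integrable_inner_sub_sq hR hmu hS i k).indicator hA
  have h4 := setIntegral_inner_sub_sq_le hR hmu hη hJ hS i k hAinfo
  rw [setIntegral_active hS i k (measurable_comp_β_info i k fun n => (η ^ (n + 1)) ^ 2)] at h4
  have hpt : ∀ ω, ‖S.iter mu J (k + 1) ω i - xs i‖ ^ 2 ≤
      (1 + τ) * (if S.χ i k ω = true then ‖G.proxBR P mu i (S.iter mu J k ω) - xs i‖ ^ 2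
        else ‖S.iter mu J k ω i - xs i‖ ^ 2)
      + (1 + τ⁻¹) * {ω | S.χ i k ω = true}.indicator
        (fun ω => ‖S.inner mu J i k ω - G.proxBR P mu i (S.iter mu J k ω)‖ ^ 2) ω := by
    intro ω
    rw [iter_succ]
    by_cases h : S.χ i k ω = true
    · simp only [h, if_true, Set.indicator_of_mem (show ω ∈ {ω | S.χ i k ω = true} from h)]
      exact norm_sub_sq_le_young _ _ _ hτ
    · have h' : ω ∉ {ω | S.χ i k ω = true} := h
      rw [if_neg h, if_neg h, Set.indicator_of_notMem h']
      nlinarith [sq_nonneg ‖S.iter mu J k ω i - xs i‖]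
  have h5 := integral_mono (integrable_iter_sub_sq hR hS hxs (k + 1) i)
    ((h1.const_mul (1 + τ)).add (h3.const_mul (1 + τ⁻¹))) hpt
  simp only [Pi.add_apply] at h5
  rw [integral_add (h1.const_mul _) (h3.const_mul _), integral_const_mul, integral_const_mul,
    h2, integral_indicator hA] at h5
  refine h5.trans (add_le_add le_rfl (mul_le_mul_of_nonneg_left h4 (by positivity)))

theorem sum_integral_proxBR_le (hR : G.Regular P M) (hmu : 0 < mu) (hS : S.Admissible P J p)
    {xs : Profile G.n} (hxs : G.IsNash P xs) (k : ℕ) :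
    ∑ i, ∫ ω, ‖G.proxBR P mu i (S.iter mu J k ω) - xs i‖ ^ 2 ∂P ≤
      G.contr P mu ^ 2 * ∑ i, S.mse P mu J xs k i := by
  have hUi : ∀ i, Integrable (fun ω => ‖G.proxBR P mu i (S.iter mu J k ω) - xs i‖ ^ 2) P :=
    fun i => integrable_norm_sub_sq hR
      ((measurable_proxBR_iter hR hmu hS i k).mono (info_le hS k) le_rfl) measurable_const
      (fun ω => (Game.proxBR_spec hR i (iter_mem hR hS k ω)).1) fun _ => hxs.1 i
  have hWi := fun i => integrable_iter_sub_sq (mu := mu) hR hS hxs.1 k i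
  simp only [mse]
  rw [← integral_finsetSum _ fun i _ => hUi i, ← integral_finsetSum _ fun i _ => hWi i,
    ← integral_const_mul]
  exact integral_mono (integrable_finsetSum _ fun i _ => hUi i)
    ((integrable_finsetSum _ fun i _ => hWi i).const_mul _)
    fun ω => Game.sum_proxBR_sub_sq_le hR hmu hxs (iter_mem hR hS k ω)

/-- With `m_i` the mean square errors and `B_i` those of the best responses, the weights turn the
update into `∑ B_i + W - ∑ m_i ≤ W - (1 - a²) ∑ m_i`. Finally `∑ m_i ≥ p_min W` produces `ã²`. -/
theorem wmse_succ_le (hR : G.Regular P M) (hmu : 0 < mu) {η : ℝ} (hη : 0 < η) (hη1 : η < 1)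
    (ha : G.contr P mu < 1) (hJ : J = stepRule (G.Q mu M) η) (hS : S.Admissible P J p)
    {xs : Profile G.n} (hxs : G.IsNash P xs) (k : ℕ) {τ : ℝ} (hτ : 0 < τ) :
    S.wmse P mu J p xs (k + 1) ≤
      (1 + τ) * (aTil p (G.contr P mu) ^ 2 * S.wmse P mu J p xs k)
        + (1 + τ⁻¹) * (Real.sqrt N * (η * etaTil p η ^ k)) ^ 2 := by
  set a := G.contr P mu
  have ha0 : 0 ≤ a := Game.contr_nonneg
  set B : Fin N → ℝ := fun i => ∫ ω, ‖G.proxBR P mu i (S.iter mu J k ω) - xs i‖ ^ 2 ∂P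
  have h1 : S.wmse P mu J p xs (k + 1) ≤
      ∑ i, ((1 + τ) * (B i + ((p i)⁻¹ - 1) * S.mse P mu J xs k i)
        + (1 + τ⁻¹) * (η * etaTil p η ^ k) ^ 2) := by
    refine Finset.sum_le_sum fun i _ => ?_
    have hpi := hS.p_pos i
    have h2 := mul_le_mul_of_nonneg_left (mse_succ_le hR hmu hη hJ hS hxs.1 k i hτ)
      (inv_nonneg.2 hpi.le)
    refine h2.trans ?_
    have h3 := mul_le_mul_of_nonneg_left (integral_inexactness_le hS hη hη1 i k)
      (by positivity : 0 ≤ 1 + τ⁻¹)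
    refine le_trans (le_of_eq ?_) (add_le_add le_rfl h3)
    simp only [B]
    field_simp
  refine h1.trans ?_
  rw [Finset.sum_add_distrib, ← Finset.mul_sum, Finset.sum_const, Finset.card_univ,
    Fintype.card_fin, nsmul_eq_mul, mul_pow (Real.sqrt N), Real.sq_sqrt (Nat.cast_nonneg N)]
  have h4 : ∑ i, (B i + ((p i)⁻¹ - 1) * S.mse P mu J xs k i)
      = ∑ i, B i + S.wmse P mu J p xs k - ∑ i, S.mse P mu J xs k i := by
    simp only [wmse, sub_mul, one_mul, Finset.sum_add_distrib, Finset.sum_sub_distrib]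
    ring
  have h5 : ∑ i, B i ≤ a ^ 2 * ∑ i, S.mse P mu J xs k i :=
    sum_integral_proxBR_le hR hmu hS hxs k
  have h6 : (⨅ i, p i) * S.wmse P mu J p xs k ≤ ∑ i, S.mse P mu J xs k i := by
    rw [wmse, Finset.mul_sum]
    refine Finset.sum_le_sum fun i _ => ?_
    rw [← mul_assoc]
    refine mul_le_of_le_one_left (mse_nonneg xs k i) ?_
    rw [mul_inv_le_iff₀ (hS.p_pos i), one_mul]
    exact iInf_p_le p i
  have h7 : a ^ 2 ≤ 1 := by nlinarith
  have h8 : ∑ i, (B i + ((p i)⁻¹ - 1) * S.mse P mu J xs k i)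
      ≤ aTil p a ^ 2 * S.wmse P mu J p xs k := by
    rw [h4, aTil_sq (p_le_one hS) ha0 ha.le]
    nlinarith
  have h9 := mul_le_mul_of_nonneg_left h8 (by positivity : 0 ≤ 1 + τ)
  linarith

/-- Optimising over `τ` after summing over players gives an additive recursion with factor exactly
`ã`, which a fixed `τ` would enlarge. -/
theorem sqrt_wmse_succ_le (hN : 0 < N) (hR : G.Regular P M) (hmu : 0 < mu) {η : ℝ} (hη : 0 < η)
    (hη1 : η < 1) (ha : G.contr P mu < 1) (hJ : J = stepRule (G.Q mu M) η)
    (hS : S.Admissible P J p) {xs : Profile G.n} (hxs : G.IsNash P xs) (k : ℕ) :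
    Real.sqrt (S.wmse P mu J p xs (k + 1)) ≤
      aTil p (G.contr P mu) * Real.sqrt (S.wmse P mu J p xs k)
        + Real.sqrt N * (η * etaTil p η ^ k) := by
  have h0 : 0 ≤ aTil p (G.contr P mu) := Real.sqrt_nonneg _
  have h1 := etaTil_pos (p_le_one hS) hη hη1.le
  have h2 : 0 < Real.sqrt N := Real.sqrt_pos.2 (by exact_mod_cast hN)
  refine Real.sqrt_le_iff.2 ⟨by positivity, le_add_sq_of_forall_young (by positivity)
    (by positivity) fun τ hτ => ?_⟩
  rw [mul_pow (aTil p _), Real.sq_sqrt (wmse_nonneg hS xs k)]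
  exact wmse_succ_le hR hmu hη hη1 ha hJ hS hxs k hτ

/-- Geometric decay of the weighted error, with the polynomial factor caused by the decreasing
inexactness. -/
theorem sqrt_wmse_le (hN : 0 < N) (hR : G.Regular P M) (hmu : 0 < mu) {η : ℝ} (hη : 0 < η)
    (hη1 : η < 1) (ha : G.contr P mu < 1) (hJ : J = stepRule (G.Q mu M) η)
    (hS : S.Admissible P J p) {xs : Profile G.n} (hxs : G.IsNash P xs) {C : ℝ} (hC : 0 ≤ C)
    (h0 : ∀ i, ∫ ω, ‖S.x0 ω i - xs i‖ ^ 2 ∂P ≤ C ^ 2) (k : ℕ) :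
    Real.sqrt (S.wmse P mu J p xs k) ≤
      Real.sqrt N * (bigCTil p C * cTil p (G.contr P mu) η ^ k
        + η * (etaTil p η)⁻¹ * (k * cTil p (G.contr P mu) η ^ k)) := by
  induction k with
  | zero => simpa using sqrt_wmse_zero_le hN hS hC h0
  | succ k ih =>
    refine (sqrt_wmse_succ_le hN hR hmu hη hη1 ha hJ hS hxs k).trans ?_
    set c := cTil p (G.contr P mu) η
    have he := etaTil_pos (p_le_one hS) hη hη1.le
    have h1 : aTil p (G.contr P mu) ≤ c := le_max_left _ _
    have h2 : etaTil p η ≤ c := le_max_right _ _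
    have h3 : 0 ≤ aTil p (G.contr P mu) := Real.sqrt_nonneg _
    have h4 := mul_le_mul h1 ih (Real.sqrt_nonneg _) (h3.trans h1)
    -- Each iteration thus adds one more copy of `η η̃⁻¹ c̃^(k+1)`, which accounts for the factor
    -- `k`.
    have h5 : η * etaTil p η ^ k ≤ η * (etaTil p η)⁻¹ * c ^ (k + 1) := by
      rw [mul_assoc]
      refine mul_le_mul_of_nonneg_left ?_ hη.le
      rw [inv_mul_eq_div, le_div_iff₀ he, ← pow_succ]
      exact pow_le_pow_left₀ he.le h2 _
    have h6 := mul_le_mul_of_nonneg_left h5 (Real.sqrt_nonneg N)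
    refine (add_le_add h4 h6).trans (le_of_eq ?_)
    push_cast
    ring

end Driver

/-! ### Elementary estimates for the complexity bound -/

/-- Apply `1 + x ≤ exp x` at `x = k ln(q/c) - 1`, so that `e k ln(q/c) ≤ (q/c)^k`; this is the
origin of the exponent `e` in `D`. -/
theorem mul_pow_le_of_lt {c q : ℝ} (hc : 0 < c) (hcq : c < q) (k : ℕ) :
    k * c ^ k ≤ 1 / Real.log ((q / c) ^ Real.exp 1) * q ^ k := by
  have hq : 0 < q := hc.trans hcq
  have hL : 0 < Real.log (q / c) := Real.log_pos ((one_lt_div hc).2 hcq)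
  have h1 : Real.log ((q / c) ^ Real.exp 1) = Real.exp 1 * Real.log (q / c) :=
    Real.log_rpow (by positivity) _
  have h2 : (q / c) ^ k = Real.exp (k * Real.log (q / c)) := by
    rw [Real.exp_nat_mul, Real.exp_log (by positivity)]
  have h3 := Real.add_one_le_exp (k * Real.log (q / c) - 1)
  rw [Real.exp_sub, ← h2, sub_add_cancel, le_div_iff₀ (Real.exp_pos 1), div_pow,
    le_div_iff₀ (by positivity)] at h3
  rw [h1, one_div_mul_eq_div, le_div_iff₀ (by positivity)]
  linarith

/-- Comparison of a geometric sum up to `⌈s⌉` with an exponential. -/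
theorem sum_pow_ceil_le {B s : ℝ} (hB : 1 < B) :
    ∑ k ∈ Finset.range ⌈s⌉₊, B ^ k ≤ B / Real.log B * B ^ s := by
  have hL : 0 < Real.log B := Real.log_pos hB
  have hB0 : 0 < B := one_pos.trans hB
  rcases le_or_gt s 0 with hs | hs
  · rw [Nat.ceil_eq_zero.2 hs]
    simp only [Finset.range_zero, Finset.sum_empty]
    positivity
  · rw [geom_sum_eq hB.ne']
    have h1 : B ^ ⌈s⌉₊ ≤ B * B ^ s := by
      rw [← Real.rpow_natCast, mul_comm, ← Real.rpow_add_one hB0.ne']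
      exact Real.rpow_le_rpow_of_exponent_le hB.le (Nat.ceil_lt_add_one hs.le).le
    have h2 : Real.log B ≤ B - 1 := Real.log_le_sub_one_of_pos hB0
    rw [div_mul_eq_mul_div, div_le_div_iff₀ (by linarith) hL]
    have h3 : 0 ≤ B ^ ⌈s⌉₊ - 1 := sub_nonneg.2 (one_le_pow₀ hB.le)
    have h4 := mul_le_mul_of_nonneg_left h2 h3
    have h5 : (B ^ ⌈s⌉₊ - 1) * (B - 1) ≤ B * B ^ s * (B - 1) :=
      mul_le_mul_of_nonneg_right (by linarith) (by linarith)
    linarith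

theorem pow_le_of_ceil_le {q x : ℝ} (hq : 0 < q) (hq1 : q < 1) (hx : 0 < x) {k : ℕ}
    (hk : ⌈Real.log (1 / x) / Real.log (1 / q)⌉₊ ≤ k) : q ^ k ≤ x := by
  have hL : 0 < Real.log (1 / q) := Real.log_pos (by rwa [one_lt_div hq])
  have h1 := Nat.ceil_le.1 hk
  rw [div_le_iff₀ hL, one_div, one_div, Real.log_inv, Real.log_inv] at h1
  rw [← Real.log_le_log_iff (by positivity) hx, Real.log_pow]
  linarith

/-- Jensen's inequality for the square, from `2RX ≤ X² + R²`. -/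
theorem integral_le_of_integral_sq_le {Ω : Type*} [MeasurableSpace Ω] {P : Measure Ω}
    [IsProbabilityMeasure P] {X : Ω → ℝ} (hX : Integrable X P)
    (hX2 : Integrable (fun ω => X ω ^ 2) P) {R : ℝ} (hR : 0 < R)
    (h : ∫ ω, X ω ^ 2 ∂P ≤ R ^ 2) : ∫ ω, X ω ∂P ≤ R := by
  have h1 : ∫ ω, 2 * R * X ω ∂P ≤ ∫ ω, (X ω ^ 2 + R ^ 2) ∂P :=
    integral_mono (hX.const_mul _) (hX2.add (integrable_const _)) fun ω => by
      simp only
      nlinarith [sq_nonneg (X ω - R)]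
  rw [integral_const_mul, integral_add hX2 (integrable_const _)] at h1
  simp only [integral_const, probReal_univ, smul_eq_mul, one_mul] at h1
  nlinarith

/-! ### Signs of the rates, identities for `qDelta`, and the order of `ellTil` -/

section Parameters

variable {N : ℕ} {p : Fin N → ℝ}

theorem one_lt_inv_etaTil0_sq {P η : ℝ} (hP : 0 < P) (h0 : 0 < η) (h1 : η < 1) :
    1 < P * ((η ^ 2)⁻¹ - 1) + 1 := by
  have h2 : 1 < (η ^ 2)⁻¹ := (one_lt_inv₀ (by positivity)).2 (by nlinarith)
  have := mul_pos hP (sub_pos.2 h2)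
  linarith

theorem etaTil0_sq {η : ℝ} (hP : 0 < ⨆ i, p i) (h0 : 0 < η) (h1 : η < 1) :
    etaTil0 p η ^ 2 = ((⨆ i, p i) * ((η ^ 2)⁻¹ - 1) + 1)⁻¹ := by
  rw [etaTil0, inv_pow, Real.sq_sqrt]
  linarith [one_lt_inv_etaTil0_sq hP h0 h1]

theorem etaTil0_pos {η : ℝ} (hP : 0 < ⨆ i, p i) (h0 : 0 < η) (h1 : η < 1) :
    0 < etaTil0 p η :=
  inv_pos.2 (Real.sqrt_pos.2 (by linarith [one_lt_inv_etaTil0_sq hP h0 h1]))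

theorem log_inv_etaTil0_pos {η : ℝ} (hP : 0 < ⨆ i, p i) (h0 : 0 < η) (h1 : η < 1) :
    0 < Real.log (etaTil0 p η)⁻¹ := by
  refine Real.log_pos ?_
  rw [etaTil0, inv_inv, Real.lt_sqrt zero_le_one, one_pow]
  exact one_lt_inv_etaTil0_sq hP h0 h1

theorem etaTil_lt_one {η : ℝ} (hp : 0 < ⨅ i, p i) (h0 : 0 < η) (h1 : η < 1) :
    etaTil p η < 1 := by
  rw [etaTil, Real.sqrt_lt' one_pos]
  have : η ^ 2 < 1 := by nlinarith
  nlinarith [mul_pos hp (sub_pos.2 this)]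

theorem log_inv_etaTil_pos (hp1 : ∀ i, p i ≤ 1) {η : ℝ} (hp : 0 < ⨅ i, p i) (h0 : 0 < η)
    (h1 : η < 1) : 0 < Real.log (etaTil p η)⁻¹ :=
  Real.log_pos ((one_lt_inv₀ (etaTil_pos hp1 h0 h1.le)).2 (etaTil_lt_one hp h0 h1))

theorem bigD_pos {a η q : ℝ} (hc : 0 < cTil p a η) (hq : cTil p a η < q) : 0 < bigD p a η q := by
  rw [bigD, Real.log_rpow (div_pos (hc.trans hq) hc)]
  have := Real.log_pos ((one_lt_div hc).2 hq)
  positivity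

theorem bigDTil_pos (hp1 : ∀ i, p i ≤ 1) {a η q : ℝ} (h0 : 0 < η) (h1 : η ≤ 1)
    (hq : cTil p a η < q) : 0 < bigDTil p a η q := by
  have h2 := etaTil_pos hp1 h0 h1
  have h3 := bigD_pos (h2.trans_le (le_max_right (aTil p a) _)) hq
  rw [bigDTil]; positivity

theorem bigCTil_nonneg {C : ℝ} (hC : 0 ≤ C) : 0 ≤ bigCTil p C :=
  mul_nonneg hC (Real.sqrt_nonneg _)

theorem epsTil_pos {a η q C ε : ℝ} (hN : 0 < N) (hP : 0 < ⨆ i, p i) (hC : 0 ≤ C)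
    (hD : 0 < bigDTil p a η q) (hε : 0 < ε) : 0 < epsTil p a η q C ε := by
  have h1 := bigCTil_nonneg (p := p) hC
  have h2 : (0 : ℝ) < N := by exact_mod_cast hN
  rw [epsTil]
  positivity

/-- The rate `ln(1/q̃)` for the choice `q̃ = qDelta`. -/
theorem log_inv_qDelta {η δ : ℝ} (he : 0 < etaTil p η) (hL : 0 < Real.log (etaTil p η)⁻¹)
    (hL0 : 0 < Real.log (etaTil0 p η)⁻¹) (hδ : 0 < δ) :
    Real.log (1 / qDelta p η δ) = Real.log (etaTil0 p η)⁻¹ /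
      (Real.log (etaTil0 p η)⁻¹ / Real.log (etaTil p η)⁻¹ + δ / 2) := by
  rw [one_div, Real.log_inv, qDelta, Real.log_mul he.ne' (Real.exp_pos _).ne', Real.log_exp]
  have e : Real.log (etaTil p η) = -Real.log (etaTil p η)⁻¹ := by rw [Real.log_inv, neg_neg]
  rw [e]
  set L := Real.log (etaTil p η)⁻¹
  set L0 := Real.log (etaTil0 p η)⁻¹
  have : 0 < L0 + L * δ / 2 := by positivity
  field_simp
  ring

theorem qDelta_lt_one {η δ : ℝ} (he : 0 < etaTil p η) (hL : 0 < Real.log (etaTil p η)⁻¹)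
    (hL0 : 0 < Real.log (etaTil0 p η)⁻¹) (hδ : 0 < δ) : qDelta p η δ < 1 := by
  have h1 := log_inv_qDelta he hL hL0 hδ
  have h2 : 0 < Real.log (1 / qDelta p η δ) := by rw [h1]; positivity
  have h3 : 0 < qDelta p η δ := mul_pos he (Real.exp_pos _)
  rw [one_div, Real.log_inv] at h2
  by_contra! h
  linarith [Real.log_nonneg h]

theorem lt_qDelta {η δ : ℝ} (he : 0 < etaTil p η) (hL : 0 < Real.log (etaTil p η)⁻¹)
    (hL0 : 0 < Real.log (etaTil0 p η)⁻¹) (hδ : 0 < δ) : etaTil p η < qDelta p η δ := by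
  rw [qDelta]
  refine lt_mul_of_one_lt_right he (Real.one_lt_exp_iff.2 ?_)
  positivity

theorem cTil_self (p : Fin N → ℝ) (η : ℝ) : cTil p η η = etaTil p η := max_self _

theorem log_one_div_etaTil0_sq (p : Fin N → ℝ) (η : ℝ) :
    Real.log (1 / etaTil0 p η ^ 2) = 2 * Real.log (etaTil0 p η)⁻¹ := by
  rw [one_div, ← inv_pow, Real.log_pow]; norm_num

/-- `qDelta` is the solution of this equation for `q̃`, so the bound of part 3 is in fact an
equality. -/
theorem exponent_qDelta {η δ : ℝ} (he : 0 < etaTil p η) (hL : 0 < Real.log (etaTil p η)⁻¹)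
    (hL0 : 0 < Real.log (etaTil0 p η)⁻¹) (hδ : 0 < δ) :
    Real.log (1 / etaTil0 p η ^ 2) / Real.log (1 / qDelta p η δ) = expo p η δ := by
  rw [log_one_div_etaTil0_sq, log_inv_qDelta he hL hL0 hδ, expo]
  generalize Real.log (etaTil p η)⁻¹ = L at *
  generalize Real.log (etaTil0 p η)⁻¹ = L0 at *
  field_simp

theorem div_log_inv_qDelta {η δ : ℝ} (he : 0 < etaTil p η) (hL : 0 < Real.log (etaTil p η)⁻¹)
    (hL0 : 0 < Real.log (etaTil0 p η)⁻¹) (hδ : 0 < δ) (x : ℝ) :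
    x / Real.log (1 / qDelta p η δ) = x * (1 / Real.log (etaTil p η)⁻¹ +
      δ / (2 * Real.log (etaTil0 p η)⁻¹)) := by
  rw [log_inv_qDelta he hL hL0 hδ]
  generalize Real.log (etaTil p η)⁻¹ = L at *
  generalize Real.log (etaTil0 p η)⁻¹ = L0 at *
  field_simp

/-- The bound `ellTil` for the choice `q̃ = qDelta`. -/
theorem ellTil_qDelta {η δ : ℝ} (he : 0 < etaTil p η) (hL : 0 < Real.log (etaTil p η)⁻¹)
    (hL0 : 0 < Real.log (etaTil0 p η)⁻¹) (hδ : 0 < δ) (i : Fin N) (Q a C ε : ℝ) :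
    ellTil p i Q a η (qDelta p η δ) C ε =
      p i * Q / (etaTil0 p η ^ 2 * η ^ 2 * Real.log (1 / etaTil0 p η ^ 2)) *
          (1 / epsTil p a η (qDelta p η δ) C ε) ^ expo p η δ
        + (⌈Real.log (1 / epsTil p a η (qDelta p η δ) C ε) *
          (1 / Real.log (etaTil p η)⁻¹ + δ / (2 * Real.log (etaTil0 p η)⁻¹))⌉₊ : ℝ) := by
  rw [ellTil, exponent_qDelta he hL hL0 hδ, div_log_inv_qDelta he hL hL0 hδ,
    mul_comm (η ^ 2) (etaTil0 p η ^ 2)]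

theorem expo_pos {η δ : ℝ} (hL : 0 < Real.log (etaTil p η)⁻¹)
    (hL0 : 0 < Real.log (etaTil0 p η)⁻¹) (hδ : 0 < δ) : 0 < expo p η δ := by
  rw [expo]; positivity

/-- The root in `C̃` is taken of an average of the `p_i⁻¹`, hence a bound free of `N`. -/
theorem bigCTil_le {C pl : ℝ} (hC : 0 ≤ C) (hN : 0 < N) (hpl : 0 < pl) (hp : ∀ i, pl ≤ p i) :
    bigCTil p C ≤ C * Real.sqrt pl⁻¹ := by
  refine mul_le_mul_of_nonneg_left (Real.sqrt_le_sqrt ?_) hC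
  have hN' : (0 : ℝ) < N := by exact_mod_cast hN
  calc ∑ i, (N : ℝ)⁻¹ * (p i)⁻¹ ≤ ∑ _i : Fin N, (N : ℝ)⁻¹ * pl⁻¹ :=
        Finset.sum_le_sum fun i _ => mul_le_mul_of_nonneg_left
          (inv_anti₀ hpl (hp i)) (inv_nonneg.2 hN'.le)
    _ = pl⁻¹ := by
        rw [Finset.sum_const, Finset.card_univ, Fintype.card_fin, nsmul_eq_mul]
        field_simp

theorem one_div_epsTil_le {a η q C ε pl : ℝ} (hC : 0 ≤ C) (hN : 0 < N) (hpl : 0 < pl)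
    (hp : ∀ i, pl ≤ p i) (hε : 0 < ε) :
    1 / epsTil p a η q C ε ≤
      Real.sqrt (⨆ i, p i) * (C * Real.sqrt pl⁻¹ + bigDTil p a η q) * (Real.sqrt N / ε) := by
  rw [epsTil, one_div_div, Real.sqrt_mul (Nat.cast_nonneg N)]
  have h1 := bigCTil_le hC hN hpl hp
  have h2 : 0 ≤ Real.sqrt N * Real.sqrt (⨆ i, p i) := by positivity
  have h3 := mul_le_mul_of_nonneg_left (add_le_add_left h1 (bigDTil p a η q)) h2
  rw [div_le_iff₀ hε]
  refine h3.trans (le_of_eq ?_)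
  field_simp

/-- The order of `ellTil` for `η = a` and `q̃ = qDelta`, with the constant written in terms of a
few parameters. -/
theorem ellTil_le {a C δ Qbar pl : ℝ} (ha0 : 0 < a) (ha1 : a < 1) (hC : 0 ≤ C) (hδ : 0 < δ)
    (hpl : 0 < pl) (hinf : (⨅ j, p j) = pl) (hp1 : ∀ i, p i ≤ 1) (i : Fin N) {Q ε : ℝ}
    (hQ0 : 0 ≤ Q) (hQ : Q ≤ Qbar) (hε : 0 < ε) (hε1 : ε ≤ 1) {W A s T x : ℝ}
    (hW : W = Real.sqrt (⨆ j, p j) *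
      (C * Real.sqrt pl⁻¹ + bigDTil p a a (qDelta p a δ)))
    (hA : A = (⨆ j, p j) * Qbar /
      (a ^ 2 * etaTil0 p a ^ 2 * Real.log (1 / etaTil0 p a ^ 2)))
    (hs : s = expo p a δ) (hT : T = Real.log (1 / qDelta p a δ)) (hx : x = Real.sqrt N / ε) :
    ellTil p i Q a a (qDelta p a δ) C ε ≤ (A * W ^ s + (W ^ s / s / T + 1)) * x ^ s := by
  have hN : 0 < N := i.pos
  have hp : ∀ j, pl ≤ p j := fun j => hinf ▸ iInf_p_le p j
  have hsup : 0 < ⨆ j, p j := (hpl.trans_le (hp i)).trans_le (le_iSup_p p i)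
  have he := etaTil_pos hp1 ha0 ha1.le
  have hL := log_inv_etaTil_pos hp1 (hinf ▸ hpl) ha0 ha1
  have hL0 := log_inv_etaTil0_pos hsup ha0 ha1
  have hs0 : 0 < s := hs ▸ expo_pos hL hL0 hδ
  have hT0 : 0 < T := by rw [hT, log_inv_qDelta he hL hL0 hδ]; positivity
  have hD := bigDTil_pos hp1 (a := a) ha0 ha1.le
    ((cTil_self p a).trans_lt (lt_qDelta he hL hL0 hδ))
  have hW0 : 0 ≤ W := by rw [hW]; positivity
  have hN1 : (1 : ℝ) ≤ N := by exact_mod_cast hN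
  have hx1 : 1 ≤ x := by
    rw [hx, one_le_div hε]
    exact hε1.trans (Real.one_le_sqrt.2 hN1)
  have hy0 := epsTil_pos hN hsup hC hD hε
  have hy := one_div_epsTil_le (a := a) (η := a) (q := qDelta p a δ) hC hN hpl hp hε
  rw [← hW, ← hx] at hy
  rw [ellTil, exponent_qDelta he hL hL0 hδ, ← hs, ← hT]
  set y := 1 / epsTil p a a (qDelta p a δ) C ε
  have hy1 : 0 < y := one_div_pos.2 hy0
  have h1 : y ^ s ≤ W ^ s * x ^ s := by
    rw [← Real.mul_rpow hW0 (by linarith)]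
    exact Real.rpow_le_rpow hy1.le hy hs0.le
  have hden : 0 < a ^ 2 * etaTil0 p a ^ 2 * Real.log (1 / etaTil0 p a ^ 2) := by
    have := etaTil0_pos hsup ha0 ha1
    rw [log_one_div_etaTil0_sq]; positivity
  have h2 : p i * Q / (a ^ 2 * etaTil0 p a ^ 2 * Real.log (1 / etaTil0 p a ^ 2)) ≤ A := by
    rw [hA]
    exact div_le_div_of_nonneg_right (mul_le_mul (le_iSup_p p i) hQ hQ0 hsup.le) hden.le
  have hA0 : 0 ≤ A := by
    rw [hA]
    exact div_nonneg (mul_nonneg hsup.le (hQ0.trans hQ)) hden.le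
  -- The logarithmic term is absorbed through `log y ≤ y^s / s`; the `1` from rounding is absorbed
  -- later by `1 ≤ x^s`.
  have h3 : (⌈Real.log y / T⌉₊ : ℝ) ≤ W ^ s / s / T * x ^ s + 1 := by
    have h4 : Real.log y / T ≤ W ^ s / s / T * x ^ s := by
      have h5 := Real.log_le_rpow_div hy1.le hs0
      calc Real.log y / T ≤ (y ^ s / s) / T := div_le_div_of_nonneg_right h5 hT0.le
        _ ≤ (W ^ s * x ^ s / s) / T :=
            div_le_div_of_nonneg_right (div_le_div_of_nonneg_right h1 hs0.le) hT0.le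
        _ = _ := by ring
    have h5 : 0 ≤ W ^ s / s / T * x ^ s := by positivity
    have h6 : (⌈Real.log y / T⌉₊ : ℝ) ≤ (⌈W ^ s / s / T * x ^ s⌉₊ : ℝ) := by
      exact_mod_cast Nat.ceil_mono h4
    exact h6.trans (Nat.ceil_lt_add_one h5).le
  have h7 : 1 ≤ x ^ s := Real.one_le_rpow hx1 hs0.le
  have h8 := mul_le_mul h2 h1 (by positivity) hA0
  calc _ ≤ A * (W ^ s * x ^ s) + (W ^ s / s / T * x ^ s + x ^ s) :=
        add_le_add h8 (h3.trans (by linarith))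
    _ = _ := by ring

end Parameters

namespace Driver

variable {N d : ℕ} {Ω : Type*} [MeasurableSpace Ω] {G : Game N d Ω} {S : Driver G}
  {P : Measure Ω} {M : Fin N → ℝ} {mu : ℝ} {J : Fin N → ℕ → ℕ} {p : Fin N → ℝ}
  [IsProbabilityMeasure P]

/-! ### Accuracy of the iterates and number of steps -/

/-- The unweighted error is at most `p_max W_k`, and `k c̃^k ≤ D q̃^k` removes the polynomial
factor; Jensen passes to the first moment. -/
theorem integral_profileDist_le (hN : 0 < N) (hR : G.Regular P M) (hmu : 0 < mu) {η : ℝ}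
    (hη : 0 < η) (hη1 : η < 1) (ha : G.contr P mu < 1) (hJ : J = stepRule (G.Q mu M) η)
    (hS : S.Admissible P J p) {xs : Profile G.n} (hxs : G.IsNash P xs) {C : ℝ} (hC : 0 ≤ C)
    (h0 : ∀ i, ∫ ω, ‖S.x0 ω i - xs i‖ ^ 2 ∂P ≤ C ^ 2) {q : ℝ}
    (hq : cTil p (G.contr P mu) η < q) (k : ℕ) :
    Integrable (fun ω => profileDist (S.iter mu J k ω) xs) P ∧
    ∫ ω, profileDist (S.iter mu J k ω) xs ∂P ≤
      Real.sqrt (N * ⨆ i, p i) * (bigCTil p C + bigDTil p (G.contr P mu) η q) * q ^ k := by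
  have hW := fun i => integrable_iter_sub_sq (mu := mu) hR hS hxs.1 k i
  have hsq : ∀ ω, profileDist (S.iter mu J k ω) xs ^ 2 = ∑ i, ‖S.iter mu J k ω i - xs i‖ ^ 2 :=
    fun ω => Real.sq_sqrt (Finset.sum_nonneg fun i _ => by positivity)
  have hX2 : Integrable (fun ω => profileDist (S.iter mu J k ω) xs ^ 2) P := by
    simp_rw [hsq]
    exact integrable_finsetSum _ fun i _ => hW i
  have hXm : Measurable fun ω => profileDist (S.iter mu J k ω) xs :=
    (Finset.measurable_fun_sum _ fun i _ =>
      ((measurable_iter_apply hR hS k i).sub_const (xs i)).norm.pow_const 2).sqrt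
  have hX : Integrable (fun ω => profileDist (S.iter mu J k ω) xs) P :=
    ((memLp_two_iff_integrable_sq hXm.aestronglyMeasurable).2 hX2).integrable (by norm_num)
  set c := cTil p (G.contr P mu) η
  have he := etaTil_pos (p_le_one hS) hη hη1.le
  have hc : 0 < c := he.trans_le (le_max_right _ _)
  have hcq : c < q := hq
  have hD := bigDTil_pos (p_le_one hS) hη hη1.le hq
  have hC' := bigCTil_nonneg (p := p) hC
  have hN' : (0 : ℝ) < N := by exact_mod_cast hN
  have hsup : 0 < ⨆ i, p i := (hS.p_pos ⟨0, hN⟩).trans_le (le_iSup_p p _)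
  have hq0 : 0 < q := hc.trans hq
  refine ⟨hX, integral_le_of_integral_sq_le hX hX2 (by positivity) ?_⟩
  simp_rw [hsq]
  rw [integral_finsetSum _ fun i _ => hW i]
  have h1 : ∑ i, ∫ ω, ‖S.iter mu J k ω i - xs i‖ ^ 2 ∂P ≤
      (⨆ i, p i) * S.wmse P mu J p xs k := by
    rw [wmse, Finset.mul_sum]
    refine Finset.sum_le_sum fun i _ => ?_
    rw [← mul_assoc]
    refine le_mul_of_one_le_left (mse_nonneg xs k i) ?_
    rw [← div_eq_mul_inv, one_le_div (hS.p_pos i)]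
    exact le_iSup_p p i
  have h2 : Real.sqrt (S.wmse P mu J p xs k) ≤
      Real.sqrt N * ((bigCTil p C + bigDTil p (G.contr P mu) η q) * q ^ k) := by
    refine (sqrt_wmse_le hN hR hmu hη hη1 ha hJ hS hxs hC h0 k).trans
      (mul_le_mul_of_nonneg_left ?_ (Real.sqrt_nonneg _))
    rw [add_mul]
    refine add_le_add (mul_le_mul_of_nonneg_left (pow_le_pow_left₀ hc.le hq.le k) hC') ?_
    have h3 := mul_pow_le_of_lt hc hcq k
    have h4 := mul_le_mul_of_nonneg_left h3 (by positivity : 0 ≤ η * (etaTil p η)⁻¹)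
    refine h4.trans (le_of_eq ?_)
    simp only [bigDTil, bigD, c]
    ring
  have h3 := pow_le_pow_left₀ (Real.sqrt_nonneg _) h2 2
  rw [Real.sq_sqrt (wmse_nonneg hS xs k)] at h3
  refine h1.trans ((mul_le_mul_of_nonneg_left h3 hsup.le).trans (le_of_eq ?_))
  rw [Real.sqrt_mul hN'.le, mul_pow, mul_pow, mul_pow, mul_pow, mul_pow, Real.sq_sqrt hN'.le,
    Real.sq_sqrt hsup.le]
  ring

/-- Activation at time `k` is independent of `β`, which yields the factor `p_i`, and `E η^(-2β)` is
at most `η̃₀^(-2k)`. Rounding the step counts up costs at most `p_i ≤ 1` per iteration, hence the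
summand `K`. -/
theorem integral_numSteps_le (hη : 0 < η) (hη1 : η < 1) {Q : Fin N → ℝ} (hQ : ∀ i, 0 ≤ Q i)
    (hJ : J = stepRule Q η)
    (hS : S.Admissible P J p) (i : Fin N) (K : ℕ) :
    Integrable (S.numSteps J i K) P ∧
    ∫ ω, S.numSteps J i K ω ∂P ≤
      p i * Q i / η ^ 2 * ∑ k ∈ Finset.range K, ((⨆ j, p j) * ((η ^ 2)⁻¹ - 1) + 1) ^ k + K := by
  have hk := fun k => integral_ite_active hS i k
    (measurable_comp_β_info i k fun n => (J i n : ℝ)) (measurable_const (a := (0 : ℝ)))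
    (integrable_comp_β hS i k fun n => (J i n : ℝ)) (integrable_const _)
  refine ⟨integrable_finsetSum _ fun k _ => (hk k).1, ?_⟩
  simp only [numSteps]
  rw [integral_finsetSum _ fun k _ => (hk k).1, Finset.mul_sum]
  have hcard : (K : ℝ) = ∑ _k ∈ Finset.range K, (1 : ℝ) := by simp
  rw [hcard, ← Finset.sum_add_distrib]
  refine Finset.sum_le_sum fun k _ => ?_
  rw [(hk k).2, integral_zero, mul_zero, add_zero]
  have hpi := hS.p_pos i
  have hpi1 := p_le_one hS i
  have hη2 : 1 < (η ^ 2)⁻¹ := (one_lt_inv₀ (by positivity)).2 (by nlinarith)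
  have h1 : ∫ ω, (J i (S.β i k ω) : ℝ) ∂P ≤
      ∫ ω, (Q i / η ^ 2 * ((η ^ 2)⁻¹) ^ S.β i k ω + 1) ∂P := by
    refine integral_mono (integrable_comp_β hS i k fun n => (J i n : ℝ))
      (integrable_comp_β hS i k fun n => Q i / η ^ 2 * ((η ^ 2)⁻¹) ^ n + 1) fun ω => ?_
    simp only [hJ, stepRule]
    refine (Nat.ceil_lt_add_one (div_nonneg (hQ i) (by positivity))).le.trans (le_of_eq ?_)
    rw [mul_add, mul_one, pow_add, pow_mul, inv_pow]
    field_simp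
  rw [integral_add (integrable_comp_β hS i k fun n => Q i / η ^ 2 * ((η ^ 2)⁻¹) ^ n)
    (integrable_const _), integral_const_mul, integral_pow_β hS] at h1
  simp only [integral_const, probReal_univ, smul_eq_mul, one_mul] at h1
  have h2 : (1 - p i + p i * (η ^ 2)⁻¹) ^ k ≤ ((⨆ j, p j) * ((η ^ 2)⁻¹ - 1) + 1) ^ k := by
    refine pow_le_pow_left₀ (by have := mul_pos hpi (one_pos.trans hη2); linarith) ?_ k
    have := mul_le_mul_of_nonneg_right (le_iSup_p p i) (sub_nonneg.2 hη2.le)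
    linarith
  have h3 := mul_le_mul_of_nonneg_left h2 (div_nonneg (hQ i) (by positivity : 0 ≤ η ^ 2))
  have h4 := mul_le_mul_of_nonneg_left (h1.trans (add_le_add_left h3 1)) hpi.le
  refine h4.trans ?_
  rw [mul_add, mul_one]
  refine add_le_add (le_of_eq ?_) hpi1
  ring

end Driver

end StochNash

/-! ### Assembly of the four claims -/

open StochNash StochNash.Driver in
theorem mainTheorem8 :
    -- the complexity bound, for every game and every admissible run of the scheme
    (∀ {N d : ℕ} {Ω : Type*} [MeasurableSpace Ω] (P : Measure Ω) [IsProbabilityMeasure P]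
      (G : StochNash.Game N d Ω) (M : Fin N → ℝ) (mu η C : ℝ)
      (S : StochNash.Driver G) (p : Fin N → ℝ) (xs : StochNash.Profile G.n)
      (J : Fin N → ℕ → ℕ),
      0 < mu → 0 < η → η < 1 → 0 ≤ C →
      G.Regular P M →
      G.contr P mu < 1 →
      J = StochNash.stepRule (G.Q mu M) η →
      S.Admissible P J p →
      G.IsNash P xs →
      (∀ i, ∫ ω, ‖S.x0 ω i - xs i‖ ^ 2 ∂P ≤ C ^ 2) →
      -- the inner solves meet the inexactness criterion with `α_{i,k} = η ^ (β_{i,k} + 1)`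
      (∀ i k,
        Integrable (fun ω => ‖G.sa mu i (S.iter mu J k ω) (fun t => S.sample i k t ω)
          (J i (S.β i k ω)) - G.proxBR P mu i (S.iter mu J k ω)‖ ^ 2) P ∧
        P[fun ω => ‖G.sa mu i (S.iter mu J k ω) (fun t => S.sample i k t ω)
          (J i (S.β i k ω)) - G.proxBR P mu i (S.iter mu J k ω)‖ ^ 2 | S.info J k]
          ≤ᵐ[P] fun ω => (η ^ (S.β i k ω + 1)) ^ 2) ∧
      -- the expected number of steps of player `i` needed for an `ε`-NE₂ is at most `ℓ̃_i(η)`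
      (∀ q, StochNash.cTil p (G.contr P mu) η < q → q < 1 → ∀ ε, 0 < ε →
        ∃ K : ℕ, (∀ k, K ≤ k → G.IsEpsNE2 P xs ε (S.iter mu J k)) ∧
          ∀ i, Integrable (S.numSteps J i K) P ∧
            ∫ ω, S.numSteps J i K ω ∂P
              ≤ StochNash.ellTil p i (G.Q mu M i) (G.contr P mu) η q C ε) ∧
      -- for `η = a` and any `δ > 0`, the choice `q̃ = qDelta` gives an explicit bound
      (η = G.contr P mu → ∀ δ, 0 < δ →
        StochNash.cTil p (G.contr P mu) η < StochNash.qDelta p η δ ∧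
        StochNash.qDelta p η δ < 1 ∧
        ∀ ε, 0 < ε → ∀ i,
          StochNash.ellTil p i (G.Q mu M i) (G.contr P mu) η (StochNash.qDelta p η δ) C ε ≤
            p i * G.Q mu M i / (StochNash.etaTil0 p η ^ 2 * η ^ 2 *
                Real.log (1 / StochNash.etaTil0 p η ^ 2)) *
              (1 / StochNash.epsTil p (G.contr P mu) η (StochNash.qDelta p η δ) C ε) ^
                StochNash.expo p η δ
            + (⌈Real.log (1 / StochNash.epsTil p (G.contr P mu) η (StochNash.qDelta p η δ) C ε) *
                (1 / Real.log (StochNash.etaTil p η)⁻¹ +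
                  δ / (2 * Real.log (StochNash.etaTil0 p η)⁻¹))⌉₊ : ℝ))) ∧
    -- the order of this bound: the constant `κ` depends only on `a`, `C`, `δ`, `p_min`, `p_max`
    -- and an upper bound for `Q_i`, not on `N`, `i`, `ε`
    (∀ a C δ Qbar pl pu : ℝ, 0 < a → a < 1 → 0 ≤ C → 0 < δ → 0 < pl → pu ≤ 1 →
      ∃ κ : ℝ, ∀ (N : ℕ) (p : Fin N → ℝ) (i : Fin N) (Q ε : ℝ),
        (⨅ j, p j) = pl → (⨆ j, p j) = pu → 0 ≤ Q → Q ≤ Qbar → 0 < ε → ε ≤ 1 →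
        StochNash.ellTil p i Q a a (StochNash.qDelta p a δ) C ε ≤
          κ * (Real.sqrt N / ε) ^ StochNash.expo p a δ) := by
  refine ⟨?_, ?_⟩
  · intro N d Ω _ P _ G M mu η C S p xs J hmu hη hη1 hC hR ha hJ hS hxs h0
    -- Without players the infimum of `p` is the default `0`, so `η̃ = 1` and no `q̃` is admissible.
    have hpos : ∀ q, cTil p (G.contr P mu) η < q → q < 1 → 0 < N := fun q hq hq1 => by
      refine Nat.pos_of_ne_zero fun hN => ?_
      subst hN
      have h1 : etaTil p η = 1 := by simp [etaTil]
      have h2 : etaTil p η ≤ cTil p (G.contr P mu) η := le_max_right _ _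
      linarith
    refine ⟨fun i k => ⟨integrable_inner_sub_sq hR hmu hS i k,
      condExp_inner_sub_sq_le hR hmu hη hJ hS i k⟩, fun q hq hq1 ε hε => ?_,
      fun hηa δ hδ => ?_⟩
    · have hN := hpos q hq hq1
      have hsup : 0 < ⨆ i, p i := (hS.p_pos ⟨0, hN⟩).trans_le (le_iSup_p p _)
      have hq0 : 0 < q := (etaTil_pos (p_le_one hS) hη hη1.le).trans_le (le_max_right _ _) |>.trans hq
      have hD := bigDTil_pos (p_le_one hS) hη hη1.le hq
      have hy := epsTil_pos hN hsup hC hD hε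
      -- The witness is the second summand of `ellTil`, which therefore also pays for the rounding
      -- of the step counts.
      refine ⟨⌈Real.log (1 / epsTil p (G.contr P mu) η q C ε) / Real.log (1 / q)⌉₊,
        fun k hk => ?_, fun i => ?_⟩
      · obtain ⟨h1, h2⟩ := integral_profileDist_le hN hR hmu hη hη1 ha hJ hS hxs hC h0 hq k
        refine ⟨h1, h2.trans ?_⟩
        have h3 := pow_le_of_ceil_le hq0 hq1 hy hk
        have hC' := bigCTil_nonneg (p := p) hC
        have hN' : (0 : ℝ) < N := by exact_mod_cast hN
        have h4 : 0 < Real.sqrt (N * ⨆ i, p i) *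
            (bigCTil p C + bigDTil p (G.contr P mu) η q) := by positivity
        rwa [epsTil, le_div_iff₀ h4, mul_comm] at h3
      · obtain ⟨h1, h2⟩ := integral_numSteps_le hη hη1
          (fun i => (Game.Q_pos (P := P) hR hmu i).le) hJ hS i
          ⌈Real.log (1 / epsTil p (G.contr P mu) η q C ε) / Real.log (1 / q)⌉₊
        refine ⟨h1, h2.trans (add_le_add ?_ le_rfl)⟩
        have hB := one_lt_inv_etaTil0_sq hsup hη hη1
        rw [etaTil0_sq hsup hη hη1, one_div (_⁻¹), inv_inv]
        set B := (⨆ i, p i) * ((η ^ 2)⁻¹ - 1) + 1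
        have hB0 : 0 < B := one_pos.trans hB
        have hLB : 0 < Real.log B := Real.log_pos hB
        have hy' := one_div_pos.2 hy
        set s := Real.log (1 / epsTil p (G.contr P mu) η q C ε) / Real.log (1 / q)
        -- Both sides are `exp (log B · log(1/ε̃) / log(1/q̃))`, with `B = η̃₀⁻²`.
        have h3 : (1 / epsTil p (G.contr P mu) η q C ε) ^ (Real.log B / Real.log (1 / q))
            = B ^ s := by
          rw [Real.rpow_def_of_pos hy', Real.rpow_def_of_pos hB0]
          congr 1
          simp only [s]
          ring
        rw [h3]
        have hpQ : 0 ≤ p i * G.Q mu M i / η ^ 2 :=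
          div_nonneg (mul_nonneg (hS.p_pos i).le (Game.Q_pos (P := P) hR hmu i).le)
            (by positivity)
        refine (mul_le_mul_of_nonneg_left (sum_pow_ceil_le hB) hpQ).trans (le_of_eq ?_)
        field_simp
    -- Without players `Γ` acts on the zero space, so `a = 0`, contrary to `a = η > 0`.
    · have hN : 0 < N := by
        refine Nat.pos_of_ne_zero fun hN => ?_
        subst hN
        have h1 : G.contr P mu = 0 := by
          rw [Game.contr, norm_eq_zero]
          exact Subsingleton.elim _ _
        linarith
      have : Nonempty (Fin N) := ⟨⟨0, hN⟩⟩
      have hinf := iInf_p_pos hS.p_pos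
      have hsup : 0 < ⨆ i, p i := (hS.p_pos ⟨0, hN⟩).trans_le (le_iSup_p p _)
      have he := etaTil_pos (p_le_one hS) hη hη1.le
      have hL := log_inv_etaTil_pos (p_le_one hS) hinf hη hη1
      have hL0 := log_inv_etaTil0_pos hsup hη hη1
      refine ⟨?_, qDelta_lt_one he hL hL0 hδ, fun ε _ i =>
        (ellTil_qDelta he hL hL0 hδ i _ _ C ε).le⟩
      rw [← hηa, cTil_self]
      exact lt_qDelta he hL hL0 hδ
  · intro a C δ Qbar pl pu ha0 ha1 hC hδ hpl hpu
    -- All rates depend on `p` only through its infimum and supremum, so one vector `p'` realising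
    -- `pl` and `pu` defines `κ` for all of them. If none exists the claim is vacuous.
    by_cases hex : ∃ (N : ℕ) (p : Fin N → ℝ), (⨅ j, p j) = pl ∧ (⨆ j, p j) = pu
    · obtain ⟨N', p', hinf', hsup'⟩ := hex
      set A := pu * Qbar / (a ^ 2 * etaTil0 p' a ^ 2 * Real.log (1 / etaTil0 p' a ^ 2))
      set W := Real.sqrt pu * (C * Real.sqrt pl⁻¹ + bigDTil p' a a (qDelta p' a δ))
      set s := expo p' a δ
      refine ⟨A * W ^ s + (W ^ s / s / Real.log (1 / qDelta p' a δ) + 1), fun N p i Q ε hinf hsup hQ0 hQ hε hε1 => ?_⟩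
      have e1 := hinf.trans hinf'.symm
      have e2 := hsup.trans hsup'.symm
      have h1 : etaTil p a = etaTil p' a := by rw [etaTil, etaTil, e1]
      have h2 : etaTil0 p a = etaTil0 p' a := by rw [etaTil0, etaTil0, e2]
      have h3 : qDelta p a δ = qDelta p' a δ := by rw [qDelta, qDelta, h1, h2]
      have h4 : expo p a δ = expo p' a δ := by rw [expo, expo, h1, h2]
      have h5 : bigDTil p a a (qDelta p a δ) = bigDTil p' a a (qDelta p' a δ) := by
        rw [bigDTil, bigDTil, bigD, bigD, cTil_self, cTil_self, h1, h3]
      have hp1 : ∀ j, p j ≤ 1 := fun j => (le_iSup_p p j).trans (hsup ▸ hpu)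
      have h := ellTil_le ha0 ha1 hC hδ hpl hinf hp1 i hQ0 hQ hε hε1 rfl rfl rfl rfl rfl
      rw [h5, hsup, h2, h3, h4] at h
      rw [h3, h4]
      exact h
    · exact ⟨0, fun N p i Q ε hinf hsup => absurd ⟨N, p, hinf, hsup⟩ hex⟩
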